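/- **Setting.** Let $f(x)=\int_\Xi F(x,\xi)\,dP(\xi)$, $x\in\mathbb R^n$, be bounded from below with $f^*=\inf f$, where $P$ is a probability measure on a standard Borel space $\Xi$, $F$ is Borel, $F(x,\cdot)$ is $P$-integrable for every $x$, and $F(\cdot,\xi)$ is $P$-almost surely differentiable with $L$-Lipschitz gradient ($L>0$). Given $x_1\in\mathbb R^n$, $N\ge 1$, stepsizes $\gamma_k>0$ and a smoothing parameter $\mu>0$, the randomized stochastic gradient free (RSGF) method generates $$x_{k+1}=x_k-\gamma_k G_\mu(x_k,\xi_k,u_k),\qquad G_\mu(x,\xi,u)=\frac{F(x+\mu u,\xi)-F(x,\xi)}{\mu}\,u ,\qquad k\ge 1,$$ and outputs $x_R$, where $\mathbb P(R=k)=\dfrac{\gamma_k-2L(n+4)\gamma_k^2}{\sum_{j=1}^N[\gamma_j-2L(n+4)\gamma_j^2]}$, $k=1,\dots,N$. Here $u_k$ is a standard Gaussian vector in $\mathbb R^n$ independent of $\xi_k$ and of the history $\zeta_{[k-1]}=(\xi_i,u_i)_{i<k}$, and $R$ is independent of $\zeta_{[N]}$. The $\xi_k$ need not be independent; $F(\cdot,\xi_k)$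 is almost surely differentiable with $L$-Lipschitz gradient, and for every $k\ge1$ and every $x$, with $\sigma\ge 0$, $F(x,\xi_k)$, $\nabla_xF(x,\xi_k)$ and $\|\nabla_xF(x,\xi_k)-\nabla f(x)\|^2$ are integrable and $$\mathbb E[F(x,\xi_k)\mid\zeta_{[k-1]}]=f(x),\quad \mathbb E[\nabla_xF(x,\xi_k)\mid\zeta_{[k-1]}]=\nabla f(x),\quad \mathbb E\big[\|\nabla_xF(x,\xi_k)-\nabla f(x)\|^2\mid\zeta_{[k-1]}\big]\le\sigma^2 .$$ Put $D_f=[2(f(x_1)-f^*)/L]^{1/2}$. **Statement.** Let $\tilde D>0$, $$\gamma_k=\frac1{\sqrt{n+4}}\min\Big\{\frac1{4L\sqrt{n+4}},\frac{\tilde D}{\sigma\sqrt N}\Big\}\quad(k=1,\dots,N),\qquad 0<\mu\le\frac{D_f}{(n+4)\sqrt{2N}}$$ (the second entry of the minimum being $+\infty$ when $\sigma=0$). Then, with expectations over $R$ and $\zeta_{[N]}$: (a) $\|\nabla f(x_R)\|^2$ is integrable and $$\frac1L\,\mathbb E\|\nabla f(x_R)\|^2\le\frac{12(n+4)LD_f^2}{N}+\frac{4\sigma\sqrt{n+4}}{\sqrt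 N}\Big(\tilde D+\frac{D_f^2}{\tilde D}\Big).$$ (b) If, in addition, $f$ is convex with a minimizer $x^*$ and $\mu\le D_X/\sqrt{n+4}$, where $D_X=\|x_1-x^*\|$, then $f(x_R)-f^*$ is integrable and $$\mathbb E[f(x_R)-f^*]\le\frac{5L(n+4)D_X^2}{N}+\frac{2\sigma\sqrt{n+4}}{\sqrt N}\Big(\tilde D+\frac{D_X^2}{\tilde D}\Big).$$ (c) Consequently the iteration complexity is $O(n/\varepsilon^2)$: for every $D$ there is a constant $C>0$, depending only on $L,\sigma,\tilde D,D$, such that for all $n\ge1$, $\varepsilon\in(0,1]$ and $N\ge Cn/\varepsilon^2$, every run as above satisfies $\mathbb E\|\nabla f(x_R)\|^2\le\varepsilon$ if $D_f\le D$, and, under the additional hypotheses of (b), $\mathbb E[f(x_R)-f^*]\le\varepsilon$ if $D_X\le D$. -/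

import Mathlib

open MeasureTheory ProbabilityTheory Finset

universe u v

noncomputable section

/-- The Euclidean space `ℝⁿ`. -/
abbrev E (n : ℕ) : Type := EuclideanSpace ℝ (Fin n)

/-- The class `C^{1,1}_L(ℝⁿ)`: differentiable functions whose gradient is `L`-Lipschitz. -/
def IsC11 {n : ℕ} (L : ℝ) (f : E n → ℝ) : Prop :=
  Differentiable ℝ f ∧ ∀ x y : E n, ‖gradient f y - gradient f x‖ ≤ L * ‖y - x‖

/-- The objective `f(x) = ∫ F(x, ξ) dP(ξ)`. -/
def objective {n : ℕ} {Ξ : Type v} [MeasurableSpace Ξ] (P : Measure Ξ) (F : E n → Ξ → ℝ)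
    (x : E n) : ℝ :=
  ∫ s, F x s ∂P

/-- The optimal value `f* = inf_x f(x)` (used for `f` bounded from below). -/
def optValue {n : ℕ} (f : E n → ℝ) : ℝ := ⨅ x, f x

/-- The stochastic gradient `G(x, ξ)`: the gradient of `F(·, ξ)` at `x`. -/
def stochGrad {n : ℕ} {Ξ : Type v} (F : E n → Ξ → ℝ) (x : E n) (s : Ξ) : E n :=
  gradient (fun y => F y s) x

/-- The gradient-free estimator `G_μ(x, ξ, u) = ((F(x + μ u, ξ) - F(x, ξ)) / μ) u`. -/
def gradFree {n : ℕ} {Ξ : Type v} (F : E n → Ξ → ℝ) (μ : ℝ) (x : E n) (s : Ξ) (w : E n) : E n :=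
  ((F (x + μ • w) s - F x s) / μ) • w

/-- The search points of the randomized stochastic gradient free method, numbered from `1`:
`x_1 = x₁` and `x_{k+1} = x_k - γ_k G_μ(x_k, ξ_k, u_k)` for `k ≥ 1`.
(The value at the index `0` is a placeholder that is never used.) -/
def rsgfIterate {n : ℕ} {Ω : Type u} {Ξ : Type v} (F : E n → Ξ → ℝ) (γ : ℕ → ℝ) (μ : ℝ)
    (x₁ : E n) (ξ : ℕ → Ω → Ξ) (w : ℕ → Ω → E n) : ℕ → Ω → E n
  | 0, _ => x₁
  | 1, _ => x₁
  | k + 2, ω =>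
      rsgfIterate F γ μ x₁ ξ w (k + 1) ω
        - γ (k + 1) • gradFree F μ (rsgfIterate F γ μ x₁ ξ w (k + 1) ω)
            (ξ (k + 1) ω) (w (k + 1) ω)

/-- The output `x_R` of the method. -/
def rsgfOutput {n : ℕ} {Ω : Type u} {Ξ : Type v} (F : E n → Ξ → ℝ) (γ : ℕ → ℝ) (μ : ℝ)
    (x₁ : E n) (ξ : ℕ → Ω → Ξ) (w : ℕ → Ω → E n) (R : Ω → ℕ) (ω : Ω) : E n :=
  rsgfIterate F γ μ x₁ ξ w (R ω) ω

/-- The probability mass function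
`P_R(k) = (γ_k - 2L(n+4)γ_k²) / ∑_{j=1}^N (γ_j - 2L(n+4)γ_j²)`. -/
def rsgfPmf (n : ℕ) (L : ℝ) (γ : ℕ → ℝ) (N k : ℕ) : ℝ :=
  (γ k - 2 * L * (n + 4) * γ k ^ 2) / ∑ j ∈ Icc 1 N, (γ j - 2 * L * (n + 4) * γ j ^ 2)

/-- The constant stepsize `(n+4)^{-1/2} min {1 / (4L√(n+4)), D̃ / (σ√N)}`. For `σ = 0` the second
entry of the minimum is `+∞`, so that the minimum is the first entry. -/
def rsgfStep (n : ℕ) (L σ Dt : ℝ) (N : ℕ) : ℝ :=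
  1 / √(n + 4 : ℝ) *
    if σ = 0 then 1 / (4 * L * √(n + 4 : ℝ))
    else min (1 / (4 * L * √(n + 4 : ℝ))) (Dt / (σ * √N))

/-- `D_f = [2 (f(x₁) - f*) / L]^{1/2}`. -/
def distF {n : ℕ} (L : ℝ) (f : E n → ℝ) (x₁ : E n) : ℝ :=
  √(2 * (f x₁ - optValue f) / L)

/-- The history `ζ_{[k-1]} = ((ξ_1, u_1), …, (ξ_{k-1}, u_{k-1}))`. -/
def history {n : ℕ} {Ω : Type u} {Ξ : Type v} (ξ : ℕ → Ω → Ξ) (w : ℕ → Ω → E n) (k : ℕ)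
    (ω : Ω) : Ico 1 k → Ξ × E n :=
  fun i => (ξ i ω, w i ω)

/-- The σ-algebra generated by the history `ζ_{[k-1]}`. -/
abbrev historySigma {n : ℕ} {Ω : Type u} {Ξ : Type v} [MeasurableSpace Ξ]
    (ξ : ℕ → Ω → Ξ) (w : ℕ → Ω → E n) (k : ℕ) : MeasurableSpace Ω :=
  MeasurableSpace.comap (history ξ w k) inferInstance

/-- The stochastic program `f* = inf_x { f(x) = ∫ F(x, ξ) dP(ξ) }`: `F` is a Borel function, the
integral exists, `F(·, ξ)` is almost surely in `C^{1,1}_L`, and `f` is bounded from below. -/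
structure IsStochasticProgram {n : ℕ} {Ξ : Type v} [MeasurableSpace Ξ] (P : Measure Ξ)
    (F : E n → Ξ → ℝ) (L : ℝ) : Prop where
  measurable : Measurable (Function.uncurry F)
  integrable : ∀ x, Integrable (F x) P
  smooth : ∀ᵐ s ∂P, IsC11 L (fun x => F x s)
  bddBelow : BddBelow (Set.range (objective P F))

/-- Assumption A1, for the query points of an oracle that is called after the history `ζ_{[k-1]}`:
the stochastic gradient is conditionally unbiased, with conditional variance at most `σ²`.
The variables `ξ_k` need not be independent. -/
structure AssumptionA1 {n : ℕ} {Ω : Type u} {Ξ : Type v} [MeasurableSpace Ω] [MeasurableSpace Ξ]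
    (Pr : Measure Ω) (P : Measure Ξ) (F : E n → Ξ → ℝ) (ξ : ℕ → Ω → Ξ) (w : ℕ → Ω → E n)
    (σ : ℝ) : Prop where
  integrable : ∀ k, 1 ≤ k → ∀ x, Integrable (fun ω => stochGrad F x (ξ k ω)) Pr
  unbiased : ∀ k, 1 ≤ k → ∀ x,
    Pr[fun ω => stochGrad F x (ξ k ω) | historySigma ξ w k]
      =ᵐ[Pr] fun _ => gradient (objective P F) x
  sq_integrable : ∀ k, 1 ≤ k → ∀ x,
    Integrable (fun ω => ‖stochGrad F x (ξ k ω) - gradient (objective P F) x‖ ^ 2) Pr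
  variance_le : ∀ k, 1 ≤ k → ∀ x,
    Pr[fun ω => ‖stochGrad F x (ξ k ω) - gradient (objective P F) x‖ ^ 2 | historySigma ξ w k]
      ≤ᵐ[Pr] fun _ => σ ^ 2

/-- Assumption A3: the function values returned by the zeroth-order oracle are conditionally
unbiased. -/
structure AssumptionA3 {n : ℕ} {Ω : Type u} {Ξ : Type v} [MeasurableSpace Ω] [MeasurableSpace Ξ]
    (Pr : Measure Ω) (P : Measure Ξ) (F : E n → Ξ → ℝ) (ξ : ℕ → Ω → Ξ)
    (w : ℕ → Ω → E n) : Prop where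
  integrable : ∀ k, 1 ≤ k → ∀ x, Integrable (fun ω => F x (ξ k ω)) Pr
  unbiased : ∀ k, 1 ≤ k → ∀ x,
    Pr[fun ω => F x (ξ k ω) | historySigma ξ w k] =ᵐ[Pr] fun _ => objective P F x

/-- The randomness of the method with iteration limit `N`: `u_k` is a standard Gaussian vector
generated independently of the history and of `ξ_k`; the random iteration count `R` has the mass
function `P_R` on `{1, …, N}` and is independent of `ζ_{[N]}`; `F(·, ξ_k)` is almost surely in
`C^{1,1}_L`. -/
structure IsRSGFSampling {n : ℕ} {Ω : Type u} {Ξ : Type v} [MeasurableSpace Ω] [MeasurableSpace Ξ]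
    (Pr : Measure Ω) (F : E n → Ξ → ℝ) (ξ : ℕ → Ω → Ξ) (w : ℕ → Ω → E n) (R : Ω → ℕ)
    (L : ℝ) (γ : ℕ → ℝ) (N : ℕ) : Prop where
  measurable_noise : ∀ k, 1 ≤ k → Measurable (ξ k)
  smooth : ∀ k, 1 ≤ k → ∀ᵐ ω ∂Pr, IsC11 L (fun x => F x (ξ k ω))
  measurable_gauss : ∀ k, 1 ≤ k → Measurable (w k)
  gauss : ∀ k, 1 ≤ k → Pr.map (w k) = stdGaussian (E n)
  indep_gauss : ∀ k, 1 ≤ k → IndepFun (w k) (fun ω => (ξ k ω, history ξ w k ω)) Pr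
  measurable_count : Measurable R
  pmf : ∀ k ∈ Icc 1 N, Pr.real {ω | R ω = k} = rsgfPmf n L γ N k
  indep_count : IndepFun R (history ξ w (N + 1)) Pr

/-- A run of the randomized stochastic gradient free method with iteration limit `N`, smoothing
parameter `μ` and constant stepsize, on a stochastic program in `C^{1,1}_L` that satisfies
Assumptions A1 and A3. -/
structure IsRSGFRun {n : ℕ} {Ω : Type u} {Ξ : Type v} [MeasurableSpace Ω] [MeasurableSpace Ξ]
    (Pr : Measure Ω) (P : Measure Ξ) (F : E n → Ξ → ℝ) (ξ : ℕ → Ω → Ξ) (w : ℕ → Ω → E n)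
    (R : Ω → ℕ) (L σ Dt : ℝ) (γ : ℕ → ℝ) (μ : ℝ) (N : ℕ) : Prop where
  program : IsStochasticProgram P F L
  a1 : AssumptionA1 Pr P F ξ w σ
  a3 : AssumptionA3 Pr P F ξ w
  sampling : IsRSGFSampling Pr F ξ w R L γ N
  step : ∀ k ∈ Icc 1 N, γ k = rsgfStep n L σ Dt N
  mu_pos : 0 < μ

end

/-!
Two Lyapunov functions satisfy the same one-step recursion. Up to errors that vanish with `μ`, the
gradient estimator `G_μ(x_k, ξ_k, u_k)` has, by Gaussian moments and Stein's identity, conditional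
mean `∇f(x_k)` and conditional second moment at most `2(n + 4)(‖∇f(x_k)‖² + σ²)`. The `ξ_k` may
depend on the past, so the oracle assumptions, which concern deterministic points, are transferred
to the random point `x_k` by approximating it by simple functions of the past. Both
`(V, φ) = (2 (f - f*) / L, ‖∇f‖² / (2L))` and, for convex `f`, `(V, φ) = (‖x - x*‖², f - f*)` then
satisfy

  `E V(x_{k+1}) + γ E φ(x_k) ≤ E V(x_k) + γ (2 (n + 4) σ² γ + μ² L (n + 4)² / 2)`.

The stepsize is constant, so `R` is uniform on `{1, …, N}` and `E φ(x_R)` is the average of the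
`E φ(x_k)`, which is bounded by telescoping. Both rates follow from
`1 / γ = max (4L(n + 4)) (σ √(n + 4) √N / D̃)`.
-/

open Filter Topology
open scoped RealInnerProductSpace

namespace IsC11

variable {n : ℕ} {L : ℝ} {f : E n → ℝ}

theorem hasGradientAt (hf : IsC11 L f) (x : E n) : HasGradientAt f (gradient f x) x :=
  (hf.1 x).hasGradientAt

theorem continuous (hf : IsC11 L f) : Continuous f := hf.1.continuous

theorem continuous_gradient (hf : IsC11 L f) : Continuous (gradient f) := by
  refine LipschitzWith.continuous (K := L.toNNReal) (LipschitzWith.of_dist_le_mul fun x y => ?_)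
  rw [dist_eq_norm, dist_eq_norm]
  exact (hf.2 y x).trans (by gcongr; exact Real.le_coe_toNNReal L)

theorem hasDerivAt_line (hf : IsC11 L f) (x h : E n) (t : ℝ) :
    HasDerivAt (fun s : ℝ => f (x + s • h)) ⟪gradient f (x + t • h), h⟫ t := by
  have hline : HasDerivAt (fun s : ℝ => x + s • h) h t := by
    simpa using ((hasDerivAt_id t).smul_const h).const_add x
  exact (hf.hasGradientAt (x + t • h)).hasFDerivAt.comp_hasDerivAt t hline

theorem abs_sub_sub_inner_le (hf : IsC11 L f) (x h : E n) :
    |f (x + h) - f x - ⟪gradient f x, h⟫| ≤ L / 2 * ‖h‖ ^ 2 := by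
  have hderiv (t : ℝ) : HasDerivAt (fun s : ℝ => f (x + s • h) - f x - s * ⟪gradient f x, h⟫)
      (⟪gradient f (x + t • h), h⟫ - ⟪gradient f x, h⟫) t := by
    simpa only [id, one_mul] using ((hf.hasDerivAt_line x h t).sub_const (f x)).fun_sub
      ((hasDerivAt_id t).mul_const ⟪gradient f x, h⟫)
  have hbound (t : ℝ) : HasDerivAt (fun s : ℝ => L / 2 * ‖h‖ ^ 2 * s ^ 2) (L * ‖h‖ ^ 2 * t) t := by
    refine ((hasDerivAt_pow 2 t).const_mul (L / 2 * ‖h‖ ^ 2)).congr_deriv ?_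
    norm_num
    ring
  have hderiv_le (t : ℝ) (ht : t ∈ Set.Ico (0 : ℝ) 1) :
      ‖⟪gradient f (x + t • h), h⟫ - ⟪gradient f x, h⟫‖ ≤ L * ‖h‖ ^ 2 * t := by
    rw [← inner_sub_left]
    calc ‖⟪gradient f (x + t • h) - gradient f x, h⟫‖
        ≤ ‖gradient f (x + t • h) - gradient f x‖ * ‖h‖ := norm_inner_le_norm _ _
      _ ≤ L * ‖x + t • h - x‖ * ‖h‖ := by gcongr; exact hf.2 _ _
      _ = L * ‖h‖ ^ 2 * t := by
        rw [add_sub_cancel_left, norm_smul, Real.norm_of_nonneg ht.1]; ring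
  simpa using image_norm_le_of_norm_deriv_right_le_deriv_boundary
    (fun t _ => (hderiv t).continuousAt.continuousWithinAt)
    (fun t _ => (hderiv t).hasDerivWithinAt) (by simp) hbound hderiv_le
    (Set.right_mem_Icc.2 zero_le_one)

theorem le_add_inner (hf : IsC11 L f) (x h : E n) :
    f (x + h) ≤ f x + ⟪gradient f x, h⟫ + L / 2 * ‖h‖ ^ 2 := by
  linarith [(abs_le.1 (hf.abs_sub_sub_inner_le x h)).2]

theorem norm_gradient_le (hf : IsC11 L f) (x y : E n) :
    ‖gradient f y‖ ≤ ‖gradient f x‖ + L * ‖y - x‖ :=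
  (norm_le_norm_add_norm_sub' _ _).trans (by gcongr; exact hf.2 x y)

theorem abs_apply_le (hf : IsC11 L f) (x : E n) :
    |f x| ≤ |f 0| + ‖gradient f 0‖ * ‖x‖ + L / 2 * ‖x‖ ^ 2 := by
  have htaylor := hf.abs_sub_sub_inner_le 0 x
  rw [zero_add] at htaylor
  calc |f x| = |f 0 + ⟪gradient f 0, x⟫ + (f x - f 0 - ⟪gradient f 0, x⟫)| := by ring_nf
    _ ≤ |f 0| + |⟪gradient f 0, x⟫| + |f x - f 0 - ⟪gradient f 0, x⟫| := abs_add_three _ _ _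
    _ ≤ _ := by gcongr; exact abs_real_inner_le_norm _ _

theorem sq_norm_gradient_le (hf : IsC11 L f) (hL : 0 < L) {c : ℝ} (hc : ∀ x, c ≤ f x) (x : E n) :
    ‖gradient f x‖ ^ 2 ≤ 2 * L * (f x - c) := by
  have hstep : c ≤ f x - 1 / (2 * L) * ‖gradient f x‖ ^ 2 :=
    calc c ≤ f (x + (-(1 / L)) • gradient f x) := hc _
      _ ≤ _ := hf.le_add_inner _ _
      _ = _ := by
        rw [real_inner_smul_right, real_inner_self_eq_norm_sq, norm_smul, mul_pow, norm_neg,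
          Real.norm_of_nonneg (by positivity)]
        field_simp
        ring
  calc ‖gradient f x‖ ^ 2 = 2 * L * (1 / (2 * L) * ‖gradient f x‖ ^ 2) := by field_simp
    _ ≤ 2 * L * (f x - c) := by gcongr; linarith

theorem inner_le_of_convexOn (hf : IsC11 L f) (hconv : ConvexOn ℝ Set.univ f) (x y : E n) :
    f x + ⟪gradient f x, y - x⟫ ≤ f y := by
  have hline : ConvexOn ℝ Set.univ (fun t : ℝ => f (x + t • (y - x))) := by
    refine (hconv.comp_affineMap (AffineMap.lineMap x y : ℝ →ᵃ[ℝ] E n)).congr fun t _ => ?_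
    simp [AffineMap.lineMap_apply, add_comm]
  have hslope := hline.le_slope_of_hasDerivAt (Set.mem_univ 0) (Set.mem_univ 1) zero_lt_one
    (hf.hasDerivAt_line x (y - x) 0)
  simp only [zero_smul, add_zero, slope_def_field, one_smul, add_sub_cancel, sub_zero,
    div_one] at hslope
  linarith

theorem gradient_sub {g : E n → ℝ} {K : ℝ} (hf : IsC11 L f) (hg : IsC11 K g) (x : E n) :
    gradient (fun x => f x - g x) x = gradient f x - gradient g x := by
  refine HasGradientAt.gradient ?_
  rw [hasGradientAt_iff_hasFDerivAt, map_sub]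
  exact (hf.hasGradientAt x).hasFDerivAt.sub (hg.hasGradientAt x).hasFDerivAt

theorem sub {g : E n → ℝ} {K : ℝ} (hf : IsC11 L f) (hg : IsC11 K g) :
    IsC11 (L + K) (fun x => f x - g x) := by
  refine ⟨hf.1.sub hg.1, fun x y => ?_⟩
  rw [hf.gradient_sub hg, hf.gradient_sub hg, sub_sub_sub_comm]
  calc ‖gradient f y - gradient f x - (gradient g y - gradient g x)‖
      ≤ ‖gradient f y - gradient f x‖ + ‖gradient g y - gradient g x‖ := norm_sub_le _ _
    _ ≤ L * ‖y - x‖ + K * ‖y - x‖ := add_le_add (hf.2 _ _) (hg.2 _ _)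
    _ = _ := by ring

theorem abs_increment_sub_le (hf : IsC11 L f) (h a b : E n) :
    |f (a + h) - f a - (f (b + h) - f b)| ≤ L * ‖h‖ * ‖a - b‖ := by
  have hderiv (z : E n) : HasFDerivAt (fun z => f (z + h) - f z)
      (InnerProductSpace.toDual ℝ (E n) (gradient f (z + h) - gradient f z)) z := by
    rw [map_sub]
    exact ((hasFDerivAt_comp_add_right h).2 (hf.hasGradientAt (z + h)).hasFDerivAt).sub
      (hf.hasGradientAt z).hasFDerivAt
  refine convex_univ.norm_image_sub_le_of_norm_hasFDerivWithin_le
    (fun z _ => (hderiv z).hasFDerivWithinAt) (fun z _ => ?_) (Set.mem_univ b) (Set.mem_univ a)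
  rw [LinearIsometryEquiv.norm_map]
  simpa using hf.2 z (z + h)

theorem integrable_comp {Ω : Type*} [MeasurableSpace Ω] {Pr : Measure Ω} [IsFiniteMeasure Pr]
    (hf : IsC11 L f) {Y : Ω → E n} (hY : MemLp Y 2 Pr) : Integrable (fun ω => f (Y ω)) Pr := by
  have hnorm : Integrable (fun ω => ‖Y ω‖) Pr := (hY.integrable one_le_two).norm
  have hsq : Integrable (fun ω => ‖Y ω‖ ^ 2) Pr := hY.integrable_norm_pow two_ne_zero
  exact (((integrable_const |f 0|).add (hnorm.const_mul ‖gradient f 0‖)).add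
    (hsq.const_mul (L / 2))).mono' (hf.continuous.comp_aestronglyMeasurable hY.1)
    (.of_forall fun ω => hf.abs_apply_le (Y ω))

theorem memLp_gradient_comp {Ω : Type*} [MeasurableSpace Ω] {Pr : Measure Ω} [IsFiniteMeasure Pr]
    (hf : IsC11 L f) {Y : Ω → E n} (hY : MemLp Y 2 Pr) :
    MemLp (fun ω => gradient f (Y ω)) 2 Pr := by
  have hbound : MemLp (fun ω => ‖gradient f 0‖ + L * ‖Y ω‖) 2 Pr :=
    (memLp_const ‖gradient f 0‖).add (hY.norm.const_mul L)
  refine hbound.mono' (hf.continuous_gradient.comp_aestronglyMeasurable hY.1)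
    (.of_forall fun ω => ?_)
  simpa using hf.norm_gradient_le 0 (Y ω)

end IsC11

theorem gradient_eq_zero_of_isLocalMin {V : Type*} [NormedAddCommGroup V] [InnerProductSpace ℝ V]
    [CompleteSpace V] {f : V → ℝ} {x : V} (h : IsLocalMin f x) : gradient f x = 0 := by
  rw [gradient, h.fderiv_eq_zero, map_zero]

theorem hasGradientAt_of_abs_sub_sub_inner_le {V : Type*} [NormedAddCommGroup V]
    [InnerProductSpace ℝ V] [CompleteSpace V] {f : V → ℝ} {x g : V} {C : ℝ}
    (h : ∀ y, |f (x + y) - f x - ⟪g, y⟫| ≤ C * ‖y‖ ^ 2) : HasGradientAt f g x := by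
  rw [hasGradientAt_iff_isLittleO_nhds_zero]
  have hbigO : (fun y => f (x + y) - f x - ⟪g, y⟫) =O[𝓝 0] fun y : V => ‖y‖ ^ 2 :=
    .of_bound C (.of_forall fun y => by simpa using h y)
  exact hbigO.trans_isLittleO (Asymptotics.isLittleO_norm_pow_id one_lt_two)

section StochasticProgram

variable {n : ℕ} {L : ℝ} {α : Type*} [MeasurableSpace α] {ν : Measure α} [IsFiniteMeasure ν]
  {Φ : E n → α → ℝ}

theorem integrable_inner_stochGrad (hint : ∀ x, Integrable (Φ x) ν)
    (hsmooth : ∀ᵐ s ∂ν, IsC11 L (fun x => Φ x s)) (x v : E n) :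
    Integrable (fun s => ⟪stochGrad Φ x s, v⟫) ν := by
  have hlim : ∀ᵐ s ∂ν, Tendsto
      (fun m : ℕ => ((1 : ℝ) / (m + 1))⁻¹ * (Φ (x + ((1 : ℝ) / (m + 1)) • v) s - Φ x s)) atTop
      (𝓝 ⟪stochGrad Φ x s, v⟫) := by
    filter_upwards [hsmooth] with s hs
    simpa [Function.comp_def, stochGrad] using
      (hs.hasDerivAt_line x v 0).tendsto_slope_zero_right.comp (tendsto_nhdsWithin_iff.2
        ⟨tendsto_one_div_add_atTop_nhds_zero_nat,
          .of_forall fun m => Set.mem_Ioi.2 Nat.one_div_pos_of_nat⟩)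
  have hmeas : AEStronglyMeasurable (fun s => ⟪stochGrad Φ x s, v⟫) ν :=
    aestronglyMeasurable_of_tendsto_ae atTop
      (fun m => (((hint _).sub (hint x)).const_mul _).aestronglyMeasurable) hlim
  have hremainder : Integrable (fun s => Φ (x + v) s - Φ x s - ⟪stochGrad Φ x s, v⟫) ν := by
    refine (integrable_const (L / 2 * ‖v‖ ^ 2)).mono'
      (((hint _).sub (hint x)).aestronglyMeasurable.sub hmeas) ?_
    filter_upwards [hsmooth] with s hs using hs.abs_sub_sub_inner_le x v
  refine (((hint (x + v)).sub (hint x)).sub hremainder).congr (.of_forall fun s => ?_)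
  simp only [Pi.sub_apply, sub_sub_cancel]

theorem integrable_stochGrad (hint : ∀ x, Integrable (Φ x) ν)
    (hsmooth : ∀ᵐ s ∂ν, IsC11 L (fun x => Φ x s)) (x : E n) : Integrable (stochGrad Φ x) ν :=
  .of_eval_piLp fun i => by
    simpa [EuclideanSpace.inner_single_right] using
      integrable_inner_stochGrad hint hsmooth x (EuclideanSpace.single i 1)

theorem hasGradientAt_objective [IsProbabilityMeasure ν] (hint : ∀ x, Integrable (Φ x) ν)
    (hsmooth : ∀ᵐ s ∂ν, IsC11 L (fun x => Φ x s)) (x : E n) :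
    HasGradientAt (objective ν Φ) (∫ s, stochGrad Φ x s ∂ν) x := by
  refine hasGradientAt_of_abs_sub_sub_inner_le (C := L / 2) fun y => ?_
  have hgrad := integrable_stochGrad hint hsmooth x
  have hincr : Integrable (fun s => Φ (x + y) s - Φ x s) ν := (hint _).sub (hint x)
  rw [objective, objective, real_inner_comm, ← integral_inner hgrad,
    ← integral_sub (hint _) (hint x), ← integral_sub hincr (hgrad.const_inner y)]
  simpa using norm_integral_le_of_norm_le_const (μ := ν) (C := L / 2 * ‖y‖ ^ 2)
    (f := fun s => Φ (x + y) s - Φ x s - ⟪y, stochGrad Φ x s⟫) (by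
    filter_upwards [hsmooth] with s hs
    rw [real_inner_comm]
    exact hs.abs_sub_sub_inner_le x y)

theorem isC11_objective [IsProbabilityMeasure ν] (hint : ∀ x, Integrable (Φ x) ν)
    (hsmooth : ∀ᵐ s ∂ν, IsC11 L (fun x => Φ x s)) : IsC11 L (objective ν Φ) := by
  have hgrad (x : E n) := hasGradientAt_objective hint hsmooth x
  refine ⟨fun x => (hgrad x).differentiableAt, fun x y => ?_⟩
  rw [(hgrad x).gradient, (hgrad y).gradient, ← integral_sub
    (integrable_stochGrad hint hsmooth y) (integrable_stochGrad hint hsmooth x)]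
  simpa using norm_integral_le_of_norm_le_const (μ := ν) (C := L * ‖y - x‖)
    (f := fun s => stochGrad Φ y s - stochGrad Φ x s) (by
    filter_upwards [hsmooth] with s hs using hs.2 x y)

end StochasticProgram

section Gaussian

theorem integrable_one_add_norm_pow {W : Type*} [NormedAddCommGroup W] [NormedSpace ℝ W]
    [CompleteSpace W] [SecondCountableTopology W] [MeasurableSpace W] [BorelSpace W]
    {ν : Measure W} [IsGaussian ν] (p : ℕ) : Integrable (fun u : W => (1 + ‖u‖) ^ p) ν := by
  have hmemLp : MemLp (fun u : W => 1 + ‖u‖) p ν :=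
    (memLp_const (1 : ℝ)).add (IsGaussian.memLp_id ν p (ENNReal.natCast_ne_top p)).norm
  refine hmemLp.integrable_norm_pow'.congr (.of_forall fun u => ?_)
  simp only [Real.norm_of_nonneg (show 0 ≤ 1 + ‖u‖ by positivity)]

theorem integrable_of_abs_le_one_add_norm_pow {W : Type*} [NormedAddCommGroup W]
    [NormedSpace ℝ W] [CompleteSpace W] [SecondCountableTopology W] [MeasurableSpace W]
    [BorelSpace W] {ν : Measure W} [IsGaussian ν] {g : W → ℝ} {C : ℝ} {p : ℕ}
    (hg : AEStronglyMeasurable g ν) (hbound : ∀ u, |g u| ≤ C * (1 + ‖u‖) ^ p) :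
    Integrable g ν :=
  ((integrable_one_add_norm_pow p).const_mul C).mono' hg (.of_forall hbound)

theorem rotation_zero_apply {V : Type*} [NormedAddCommGroup V] [NormedSpace ℝ V] (z : V × V) :
    ContinuousLinearMap.rotation 0 z = z := by
  simp [ContinuousLinearMap.rotation_apply]

theorem hasDerivAt_rotation_fst {V : Type*} [NormedAddCommGroup V] [NormedSpace ℝ V]
    (z : V × V) (θ : ℝ) :
    HasDerivAt (fun t => (ContinuousLinearMap.rotation t z).1)
      (ContinuousLinearMap.rotation θ z).2 θ := by
  simp only [ContinuousLinearMap.rotation_apply]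
  exact ((Real.hasDerivAt_cos θ).smul_const z.1).add ((Real.hasDerivAt_sin θ).smul_const z.2)

theorem norm_rotation_le {V : Type*} [NormedAddCommGroup V] [NormedSpace ℝ V]
    (z : V × V) (θ : ℝ) : ‖ContinuousLinearMap.rotation θ z‖ ≤ 2 * ‖z‖ := by
  have hcomb {c s : ℝ} (hc : |c| ≤ 1) (hs : |s| ≤ 1) : ‖c • z.1 + s • z.2‖ ≤ 2 * ‖z‖ :=
    calc ‖c • z.1 + s • z.2‖ ≤ |c| * ‖z.1‖ + |s| * ‖z.2‖ := by
          simpa only [norm_smul, Real.norm_eq_abs] using norm_add_le (c • z.1) (s • z.2)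
      _ ≤ 1 * ‖z‖ + 1 * ‖z‖ := by gcongr; exacts [norm_fst_le z, norm_snd_le z]
      _ = 2 * ‖z‖ := by ring
  rw [ContinuousLinearMap.rotation_apply]
  exact norm_prod_le_iff.2 ⟨hcomb (Real.abs_cos_le_one θ) (Real.abs_sin_le_one θ),
    hcomb (by simpa using Real.abs_sin_le_one θ) (Real.abs_cos_le_one θ)⟩

theorem norm_fderiv_rotation_mul_inner_le {V : Type*} [NormedAddCommGroup V]
    [InnerProductSpace ℝ V] {f : V → ℝ} {C : ℝ} {p : ℕ}
    (hderiv : ∀ x, ‖fderiv ℝ f x‖ ≤ C * (1 + ‖x‖) ^ p) (v : V) (z : V × V) (θ : ℝ) :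
    ‖fderiv ℝ f (ContinuousLinearMap.rotation θ z).1 (ContinuousLinearMap.rotation θ z).2
      * ⟪v, z.2⟫‖ ≤ 2 ^ (p + 1) * C * ‖v‖ * (1 + ‖z‖) ^ (p + 2) := by
  have hC : 0 ≤ C := by simpa using (norm_nonneg _).trans (hderiv 0)
  have hfst : 1 + ‖(ContinuousLinearMap.rotation θ z).1‖ ≤ 2 * (1 + ‖z‖) := by
    linarith [(norm_fst_le _).trans (norm_rotation_le z θ)]
  have hsnd : ‖(ContinuousLinearMap.rotation θ z).2‖ ≤ 2 * (1 + ‖z‖) := by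
    linarith [(norm_snd_le _).trans (norm_rotation_le z θ)]
  have hinner : ‖⟪v, z.2⟫‖ ≤ ‖v‖ * (1 + ‖z‖) :=
    (norm_inner_le_norm v z.2).trans (by gcongr; linarith [norm_snd_le z])
  calc _ ≤ C * (2 * (1 + ‖z‖)) ^ p * (2 * (1 + ‖z‖)) * (‖v‖ * (1 + ‖z‖)) := by
        rw [norm_mul]
        gcongr
        refine (ContinuousLinearMap.le_opNorm _ _).trans ?_
        gcongr
        exact (hderiv _).trans (by gcongr)
    _ = 2 ^ (p + 1) * C * ‖v‖ * (1 + ‖z‖) ^ (p + 2) := by rw [mul_pow]; ring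

theorem hasFDerivAt_inner_mul_norm_sq_pow_succ {V : Type*} [NormedAddCommGroup V]
    [InnerProductSpace ℝ V] (a : V) (k : ℕ) (u : V) :
    HasFDerivAt (fun u : V => ⟪a, u⟫ * (‖u‖ ^ 2) ^ (k + 1))
      ((2 * (k + 1) * (‖u‖ ^ 2) ^ k * ⟪a, u⟫) • innerSL ℝ u + (‖u‖ ^ 2) ^ (k + 1) • innerSL ℝ a)
      u := by
  refine ((innerSL ℝ a).hasFDerivAt.mul
    ((hasStrictFDerivAt_norm_sq u).hasFDerivAt.pow (k + 1))).congr_fderiv ?_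
  ext w
  simp
  ring

theorem norm_inner_mul_norm_sq_pow_succ_deriv_le {V : Type*} [NormedAddCommGroup V]
    [InnerProductSpace ℝ V] (a : V) (k : ℕ) (u : V) :
    ‖(2 * (k + 1) * (‖u‖ ^ 2) ^ k * ⟪a, u⟫) • innerSL ℝ u + (‖u‖ ^ 2) ^ (k + 1) • innerSL ℝ a‖
      ≤ (2 * (k + 1) + 1) * ‖a‖ * ‖u‖ ^ (2 * (k + 1)) := by
  calc _ ≤ ‖2 * (k + 1) * (‖u‖ ^ 2) ^ k * ⟪a, u⟫‖ * ‖u‖ + (‖u‖ ^ 2) ^ (k + 1) * ‖a‖ := by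
        refine (norm_add_le _ _).trans_eq ?_
        rw [norm_smul, norm_smul, innerSL_apply_norm, innerSL_apply_norm,
          Real.norm_of_nonneg (by positivity : 0 ≤ (‖u‖ ^ 2) ^ (k + 1))]
    _ ≤ 2 * (k + 1) * (‖u‖ ^ 2) ^ k * (‖a‖ * ‖u‖) * ‖u‖ + (‖u‖ ^ 2) ^ (k + 1) * ‖a‖ := by
        rw [norm_mul, Real.norm_of_nonneg (by positivity : 0 ≤ 2 * (k + 1) * (‖u‖ ^ 2) ^ k)]
        gcongr
        exact norm_inner_le_norm a u
    _ = _ := by rw [pow_mul]; ring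

variable {V : Type*} [NormedAddCommGroup V] [InnerProductSpace ℝ V] [FiniteDimensional ℝ V]
  [MeasurableSpace V] [BorelSpace V]

theorem integral_inner_stdGaussian (a : V) : ∫ u, ⟪a, u⟫ ∂stdGaussian V = 0 :=
  integral_strongDual_stdGaussian (innerSL ℝ a)

theorem integral_strongDual_mul_inner_stdGaussian (A : StrongDual ℝ V) (v : V) :
    ∫ u, A u * ⟪v, u⟫ ∂stdGaussian V = A v := by
  have hcov := covarianceBilin_apply (μ := stdGaussian V) (IsGaussian.memLp_id _ 2 (by simp))
    ((InnerProductSpace.toDual ℝ V).symm A) v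
  simpa only [covarianceBilin_stdGaussian, id, integral_id_stdGaussian, innerSL_apply_apply ℝ,
    sub_zero, InnerProductSpace.toDual_symm_apply] using hcov.symm

theorem integrable_inner_stdGaussian (a : V) : Integrable (fun u => ⟪a, u⟫) (stdGaussian V) :=
  (IsGaussian.integrable_id (μ := stdGaussian V)).const_inner a

theorem integral_comp_rotation_stdGaussian {g : V × V → ℝ} (hg : Continuous g) (θ : ℝ) :
    ∫ z, g (ContinuousLinearMap.rotation θ z) ∂(stdGaussian V).prod (stdGaussian V)
      = ∫ z, g z ∂(stdGaussian V).prod (stdGaussian V) := by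
  have hmap := IsGaussian.map_rotation_eq_self_of_forall_strongDual_eq_zero
    (μ := stdGaussian V) integral_strongDual_stdGaussian θ
  rw [← integral_map (by fun_prop) hg.aestronglyMeasurable, hmap]

theorem integrable_mul_inner_stdGaussian {f : V → ℝ} (hf : Continuous f) {C : ℝ} {p : ℕ}
    (hbound : ∀ x, |f x| ≤ C * (1 + ‖x‖) ^ p) (v : V) :
    Integrable (fun u => f u * ⟪v, u⟫) (stdGaussian V) := by
  refine integrable_of_abs_le_one_add_norm_pow (C := C * ‖v‖) (p := p + 1)
    (by fun_prop) fun u => ?_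
  rw [abs_mul]
  calc |f u| * |⟪v, u⟫| ≤ C * (1 + ‖u‖) ^ p * (‖v‖ * (1 + ‖u‖)) := by
        gcongr
        · exact (abs_nonneg _).trans (hbound u)
        · exact hbound u
        · exact (abs_real_inner_le_norm v u).trans (by gcongr; linarith)
    _ = C * ‖v‖ * (1 + ‖u‖) ^ (p + 1) := by ring

theorem integral_comp_rotation_fst_mul_inner {f : V → ℝ} (hf : Continuous f) {C : ℝ} {p : ℕ}
    (hbound : ∀ x, |f x| ≤ C * (1 + ‖x‖) ^ p) (v : V) (θ : ℝ) :
    ∫ z : V × V, f (ContinuousLinearMap.rotation θ z).1 * ⟪v, z.2⟫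
        ∂(stdGaussian V).prod (stdGaussian V)
      = Real.sin θ * ∫ u, f u * ⟪v, u⟫ ∂stdGaussian V := by
  have hf_int : Integrable f (stdGaussian V) :=
    integrable_of_abs_le_one_add_norm_pow hf.aestronglyMeasurable hbound
  have hmul_int := integrable_mul_inner_stdGaussian hf hbound v
  have hsnd (z : V × V) :
      z.2 = Real.sin θ • (ContinuousLinearMap.rotation θ z).1
        + Real.cos θ • (ContinuousLinearMap.rotation θ z).2 := by
    simp only [ContinuousLinearMap.rotation_apply, smul_add, smul_smul]
    linear_combination (norm := module) (-Real.sin_sq_add_cos_sq θ) • z.2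
  calc ∫ z : V × V, f (ContinuousLinearMap.rotation θ z).1 * ⟪v, z.2⟫
          ∂(stdGaussian V).prod (stdGaussian V)
      = ∫ z : V × V, f (ContinuousLinearMap.rotation θ z).1 *
          ⟪v, Real.sin θ • (ContinuousLinearMap.rotation θ z).1
            + Real.cos θ • (ContinuousLinearMap.rotation θ z).2⟫
          ∂(stdGaussian V).prod (stdGaussian V) := by
        simp only [← hsnd]
    _ = ∫ z : V × V, (Real.sin θ * (f z.1 * ⟪v, z.1⟫) + Real.cos θ * (f z.1 * ⟪v, z.2⟫))
          ∂(stdGaussian V).prod (stdGaussian V) := by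
        refine Eq.trans (integral_congr_ae (.of_forall fun z => ?_))
          (integral_comp_rotation_stdGaussian (by fun_prop) θ)
        simp only
        rw [inner_add_right, real_inner_smul_right, real_inner_smul_right]
        ring
    _ = _ := by
        rw [integral_add ((hmul_int.comp_fst _).const_mul _)
          ((hf_int.mul_prod (integrable_inner_stdGaussian v)).const_mul _), integral_const_mul,
          integral_const_mul, integral_prod_mul f (fun u => ⟪v, u⟫), integral_inner_stdGaussian,
          integral_fun_fst (fun u => f u * ⟪v, u⟫)]
        simp

theorem integrable_fderiv_mul_inner {f : V → ℝ} {C : ℝ} {p : ℕ}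
    (hderiv : ∀ x, ‖fderiv ℝ f x‖ ≤ C * (1 + ‖x‖) ^ p) (v : V) :
    Integrable (fun z : V × V => fderiv ℝ f z.1 z.2 * ⟪v, z.2⟫)
      ((stdGaussian V).prod (stdGaussian V)) := by
  have hmeas : Measurable fun z : V × V => fderiv ℝ f z.1 z.2 :=
    isBoundedBilinearMap_apply.continuous.measurable.comp
      (((measurable_fderiv ℝ f).comp measurable_fst).prodMk measurable_snd)
  exact integrable_of_abs_le_one_add_norm_pow (by fun_prop) fun z => by
    simpa only [rotation_zero_apply, Real.norm_eq_abs] using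
      norm_fderiv_rotation_mul_inner_le hderiv v z 0

theorem hasDerivAt_integral_comp_rotation_fst_mul_inner {f : V → ℝ} (hf : Differentiable ℝ f)
    {C : ℝ} {p : ℕ} (hbound : ∀ x, |f x| ≤ C * (1 + ‖x‖) ^ p)
    (hderiv : ∀ x, ‖fderiv ℝ f x‖ ≤ C * (1 + ‖x‖) ^ p) (v : V) :
    HasDerivAt (fun θ => ∫ z : V × V, f (ContinuousLinearMap.rotation θ z).1 * ⟪v, z.2⟫
        ∂(stdGaussian V).prod (stdGaussian V))
      (∫ z : V × V, fderiv ℝ f z.1 z.2 * ⟪v, z.2⟫ ∂(stdGaussian V).prod (stdGaussian V)) 0 := by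
  have hcont : Continuous f := hf.continuous
  have hderiv_rotation (z : V × V) (θ : ℝ) :
      HasDerivAt (fun t => f (ContinuousLinearMap.rotation t z).1 * ⟪v, z.2⟫)
        (fderiv ℝ f (ContinuousLinearMap.rotation θ z).1 (ContinuousLinearMap.rotation θ z).2
          * ⟪v, z.2⟫) θ :=
    ((hf _).hasFDerivAt.comp_hasDerivAt θ (hasDerivAt_rotation_fst z θ)).mul_const _
  have hint_zero : Integrable
      (fun z : V × V => f (ContinuousLinearMap.rotation 0 z).1 * ⟪v, z.2⟫)
      ((stdGaussian V).prod (stdGaussian V)) := by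
    simp only [rotation_zero_apply]
    exact (integrable_of_abs_le_one_add_norm_pow hcont.aestronglyMeasurable hbound).mul_prod
      (integrable_inner_stdGaussian v)
  have hdiff := (hasDerivAt_integral_of_dominated_loc_of_deriv_le univ_mem
    (.of_forall fun θ => by fun_prop) hint_zero
    (by simpa only [rotation_zero_apply] using (integrable_fderiv_mul_inner hderiv v).1)
    (.of_forall fun z θ _ => norm_fderiv_rotation_mul_inner_le hderiv v z θ)
    ((integrable_one_add_norm_pow (p + 2)).const_mul _)
    (.of_forall fun z θ _ => hderiv_rotation z θ)).2
  simpa only [rotation_zero_apply] using hdiff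

/- Differentiating at `θ = 0` the rotation identity `E f(cos θ • u + sin θ • u') ⟪v, u'⟫ =
sin θ * E f(u) ⟪v, u⟫` for two independent standard Gaussians. -/
theorem integral_mul_inner_stdGaussian {f : V → ℝ} (hf : Differentiable ℝ f) {C : ℝ} {p : ℕ}
    (hbound : ∀ x, |f x| ≤ C * (1 + ‖x‖) ^ p) (hderiv : ∀ x, ‖fderiv ℝ f x‖ ≤ C * (1 + ‖x‖) ^ p)
    (v : V) : ∫ u, f u * ⟪v, u⟫ ∂stdGaussian V = ∫ u, fderiv ℝ f u v ∂stdGaussian V := by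
  have hdiff := hasDerivAt_integral_comp_rotation_fst_mul_inner hf hbound hderiv v
  simp only [integral_comp_rotation_fst_mul_inner hf.continuous hbound] at hdiff
  have hsin : HasDerivAt (fun θ => Real.sin θ * ∫ u, f u * ⟪v, u⟫ ∂stdGaussian V)
      (∫ u, f u * ⟪v, u⟫ ∂stdGaussian V) 0 := by
    simpa using (Real.hasDerivAt_sin 0).mul_const (∫ u, f u * ⟪v, u⟫ ∂stdGaussian V)
  rw [hsin.unique hdiff, integral_prod _ (integrable_fderiv_mul_inner hderiv v)]
  simp only [integral_strongDual_mul_inner_stdGaussian]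

theorem integrable_inner_sq_mul_norm_pow_stdGaussian (a : V) (k : ℕ) :
    Integrable (fun u => ⟪a, u⟫ ^ 2 * ‖u‖ ^ k) (stdGaussian V) := by
  refine integrable_of_abs_le_one_add_norm_pow (C := ‖a‖ ^ 2) (p := k + 2) (by fun_prop)
    fun u => ?_
  rw [abs_mul, abs_pow, abs_of_nonneg (by positivity : 0 ≤ ‖u‖ ^ k)]
  calc |⟪a, u⟫| ^ 2 * ‖u‖ ^ k ≤ (‖a‖ * (1 + ‖u‖)) ^ 2 * (1 + ‖u‖) ^ k := by
        gcongr
        · exact (abs_real_inner_le_norm a u).trans (by gcongr; linarith)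
        · linarith
    _ = ‖a‖ ^ 2 * (1 + ‖u‖) ^ (k + 2) := by ring

theorem integrable_norm_pow_stdGaussian (k : ℕ) :
    Integrable (fun u : V => ‖u‖ ^ k) (stdGaussian V) := by
  refine integrable_of_abs_le_one_add_norm_pow (C := 1) (p := k) (by fun_prop) fun u => ?_
  rw [abs_of_nonneg (by positivity), one_mul]
  gcongr
  linarith

theorem integral_inner_sq_mul_norm_pow_succ_stdGaussian (a : V) (k : ℕ) :
    ∫ u, ⟪a, u⟫ ^ 2 * ‖u‖ ^ (2 * (k + 1)) ∂stdGaussian V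
      = ‖a‖ ^ 2 * ∫ u, ‖u‖ ^ (2 * (k + 1)) ∂stdGaussian V
        + 2 * (k + 1) * ∫ u, ⟪a, u⟫ ^ 2 * ‖u‖ ^ (2 * k) ∂stdGaussian V := by
  have hderiv := hasFDerivAt_inner_mul_norm_sq_pow_succ a (k := k)
  have hstein := integral_mul_inner_stdGaussian (fun u => (hderiv u).differentiableAt)
    (C := (2 * (k + 1) + 1) * ‖a‖) (p := 2 * (k + 1) + 1) (fun u => ?_) (fun u => ?_) a
  · simp only [(hderiv _).fderiv] at hstein
    rw [← integral_const_mul, ← integral_const_mul,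
      ← integral_add ((integrable_norm_pow_stdGaussian _).const_mul _)
        ((integrable_inner_sq_mul_norm_pow_stdGaussian a _).const_mul _)]
    refine Eq.trans (Eq.trans ?_ hstein) ?_
    · congr! 2 with u
      rw [pow_mul]
      ring
    · congr! 2 with u
      simp only [_root_.add_apply, _root_.smul_apply, smul_eq_mul, innerSL_apply_apply,
        real_inner_self_eq_norm_sq, real_inner_comm u a, pow_mul]
      ring
  · calc |⟪a, u⟫ * (‖u‖ ^ 2) ^ (k + 1)| ≤ ‖a‖ * ‖u‖ * (‖u‖ ^ 2) ^ (k + 1) := by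
          rw [abs_mul, abs_of_nonneg (by positivity : 0 ≤ (‖u‖ ^ 2) ^ (k + 1))]
          gcongr
          exact abs_real_inner_le_norm a u
      _ = 1 * ‖a‖ * ‖u‖ ^ (2 * (k + 1) + 1) := by rw [← pow_mul]; ring
      _ ≤ _ := by gcongr <;> linarith
  · rw [(hderiv u).fderiv]
    calc _ ≤ (2 * (k + 1) + 1) * ‖a‖ * ‖u‖ ^ (2 * (k + 1)) :=
          norm_inner_mul_norm_sq_pow_succ_deriv_le a k u
      _ ≤ (2 * (k + 1) + 1) * ‖a‖ * (1 + ‖u‖) ^ (2 * (k + 1)) := by gcongr; linarith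
      _ ≤ _ := by gcongr <;> [linarith [norm_nonneg u]; omega]

theorem integral_norm_pow_succ_eq_sum_stdGaussian (k : ℕ) :
    ∫ u : V, ‖u‖ ^ (2 * (k + 1)) ∂stdGaussian V
      = ∑ i, ∫ u, ⟪stdOrthonormalBasis ℝ V i, u⟫ ^ 2 * ‖u‖ ^ (2 * k) ∂stdGaussian V := by
  rw [← integral_finsetSum _ fun i _ => integrable_inner_sq_mul_norm_pow_stdGaussian _ _]
  congr! 2 with u
  rw [← Finset.sum_mul, (stdOrthonormalBasis ℝ V).sum_sq_inner_right]
  ring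

theorem integral_inner_sq_mul_norm_pow_stdGaussian (a : V) (k : ℕ) :
    ∫ u, ⟪a, u⟫ ^ 2 * ‖u‖ ^ (2 * k) ∂stdGaussian V
      = ‖a‖ ^ 2 * ∏ i ∈ range k, (Module.finrank ℝ V + 2 * (i + 1) : ℝ) := by
  induction k generalizing a with
  | zero =>
    simpa [pow_two] using integral_strongDual_mul_inner_stdGaussian (innerSL ℝ a) a
  | succ k ih =>
    rw [integral_inner_sq_mul_norm_pow_succ_stdGaussian, integral_norm_pow_succ_eq_sum_stdGaussian,
      prod_range_succ]
    simp only [ih, (stdOrthonormalBasis ℝ V).norm_eq_one, sum_const, card_univ, Fintype.card_fin,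
      nsmul_eq_mul]
    ring

theorem integral_norm_pow_stdGaussian (k : ℕ) :
    ∫ u : V, ‖u‖ ^ (2 * k) ∂stdGaussian V
      = ∏ i ∈ range k, (Module.finrank ℝ V + 2 * i : ℝ) := by
  cases k with
  | zero => simp
  | succ k =>
    rw [integral_norm_pow_succ_eq_sum_stdGaussian, prod_range_succ']
    simp only [integral_inner_sq_mul_norm_pow_stdGaussian,
      (stdOrthonormalBasis ℝ V).norm_eq_one, sum_const, card_univ, Fintype.card_fin, nsmul_eq_mul]
    push_cast
    ring

end Gaussian

/-- The forward difference quotient of `f` at `x` along `u` with smoothing parameter `μ`, the scalar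
factor of the gradient-free estimator `gradFree`. -/
noncomputable def diffQuotient {n : ℕ} (f : E n → ℝ) (μ : ℝ) (x u : E n) : ℝ :=
  (f (x + μ • u) - f x) / μ

namespace IsC11

variable {n : ℕ} {L μ : ℝ} {f : E n → ℝ}

theorem continuous_diffQuotient (hf : IsC11 L f) (x : E n) : Continuous (diffQuotient f μ x) := by
  have := hf.continuous
  unfold diffQuotient
  fun_prop

theorem abs_diffQuotient_sub_inner_le (hf : IsC11 L f) (hμ : 0 < μ) (x u : E n) :
    |diffQuotient f μ x u - ⟪gradient f x, u⟫| ≤ μ * L / 2 * ‖u‖ ^ 2 := by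
  have htaylor := hf.abs_sub_sub_inner_le x (μ • u)
  rw [real_inner_smul_right, norm_smul, Real.norm_of_nonneg hμ.le] at htaylor
  have hdiv : diffQuotient f μ x u - ⟪gradient f x, u⟫
      = (f (x + μ • u) - f x - μ * ⟪gradient f x, u⟫) / μ := by
    rw [diffQuotient]; field_simp
  rw [hdiv, abs_div, abs_of_pos hμ, div_le_iff₀ hμ]
  linarith

theorem sq_diffQuotient_sub_inner_le (hf : IsC11 L f) (hμ : 0 < μ) (x u : E n) :
    (diffQuotient f μ x u - ⟪gradient f x, u⟫) ^ 2 ≤ (μ * L / 2 * ‖u‖ ^ 2) ^ 2 :=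
  sq_le_sq.2 ((hf.abs_diffQuotient_sub_inner_le hμ x u).trans (le_abs_self _))

theorem abs_diffQuotient_le (hf : IsC11 L f) (hμ : 0 < μ) (x u : E n) :
    |diffQuotient f μ x u| ≤ ‖gradient f x‖ * ‖u‖ + μ * L / 2 * ‖u‖ ^ 2 := by
  have happrox := abs_le.1 (hf.abs_diffQuotient_sub_inner_le hμ x u)
  have hinner := abs_le.1 (abs_real_inner_le_norm (gradient f x) u)
  rw [abs_le]
  constructor <;> linarith

theorem abs_diffQuotient_sub_le (hf : IsC11 L f) (hμ : 0 < μ) (a b u : E n) :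
    |diffQuotient f μ a u - diffQuotient f μ b u| ≤ L * ‖u‖ * ‖a - b‖ := by
  have hincr := hf.abs_increment_sub_le (μ • u) a b
  rw [norm_smul, Real.norm_of_nonneg hμ.le] at hincr
  rw [diffQuotient, diffQuotient, ← sub_div, abs_div, abs_of_pos hμ, div_le_iff₀ hμ]
  linarith

theorem sq_norm_diffQuotient_smul_le (hf : IsC11 L f) (hμ : 0 < μ) (x u : E n) :
    ‖diffQuotient f μ x u • u‖ ^ 2
      ≤ 2 * (⟪gradient f x, u⟫ ^ 2 * ‖u‖ ^ (2 * 1)) + μ ^ 2 * L ^ 2 / 2 * ‖u‖ ^ (2 * 3) := by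
  have hsq : diffQuotient f μ x u ^ 2
      ≤ 2 * ⟪gradient f x, u⟫ ^ 2 + 2 * (μ * L / 2 * ‖u‖ ^ 2) ^ 2 := by
    nlinarith [hf.sq_diffQuotient_sub_inner_le hμ x u,
      sq_nonneg (diffQuotient f μ x u - 2 * ⟪gradient f x, u⟫)]
  calc ‖diffQuotient f μ x u • u‖ ^ 2 = diffQuotient f μ x u ^ 2 * ‖u‖ ^ 2 := by
        rw [norm_smul, mul_pow, Real.norm_eq_abs, sq_abs]
    _ ≤ (2 * ⟪gradient f x, u⟫ ^ 2 + 2 * (μ * L / 2 * ‖u‖ ^ 2) ^ 2) * ‖u‖ ^ 2 := by gcongr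
    _ = _ := by ring

theorem integrable_sq_norm_diffQuotient_smul (hf : IsC11 L f) (hμ : 0 < μ) (x : E n) :
    Integrable (fun u => ‖diffQuotient f μ x u • u‖ ^ 2) (stdGaussian (E n)) := by
  refine Integrable.mono'
    (((integrable_inner_sq_mul_norm_pow_stdGaussian (gradient f x) (2 * 1)).const_mul 2).add
      ((integrable_norm_pow_stdGaussian (2 * 3)).const_mul (μ ^ 2 * L ^ 2 / 2)))
    (((hf.continuous_diffQuotient x).smul continuous_id).norm.pow 2).aestronglyMeasurable
    (.of_forall fun u => ?_)
  rw [Real.norm_of_nonneg (by positivity)]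
  exact hf.sq_norm_diffQuotient_smul_le hμ x u

theorem integral_sq_norm_diffQuotient_smul_le (hf : IsC11 L f) (hμ : 0 < μ) (x : E n) :
    ∫ u, ‖diffQuotient f μ x u • u‖ ^ 2 ∂stdGaussian (E n)
      ≤ 2 * (n + 4) * ‖gradient f x‖ ^ 2 + μ ^ 2 * L ^ 2 / 2 * (n + 4) ^ 3 := by
  have hquad := (integrable_inner_sq_mul_norm_pow_stdGaussian (gradient f x) (2 * 1)).const_mul 2
  have hsix := (integrable_norm_pow_stdGaussian (V := E n) (2 * 3)).const_mul (μ ^ 2 * L ^ 2 / 2)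
  calc ∫ u, ‖diffQuotient f μ x u • u‖ ^ 2 ∂stdGaussian (E n)
      ≤ ∫ u, (2 * (⟪gradient f x, u⟫ ^ 2 * ‖u‖ ^ (2 * 1)) + μ ^ 2 * L ^ 2 / 2 * ‖u‖ ^ (2 * 3))
          ∂stdGaussian (E n) :=
        integral_mono (hf.integrable_sq_norm_diffQuotient_smul hμ x) (hquad.add hsix)
          (hf.sq_norm_diffQuotient_smul_le hμ x)
    _ = 2 * ((n + 2) * ‖gradient f x‖ ^ 2) + μ ^ 2 * L ^ 2 / 2 * (n * (n + 2) * (n + 4)) := by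
        rw [integral_add hquad hsix, integral_const_mul, integral_const_mul,
          integral_inner_sq_mul_norm_pow_stdGaussian, integral_norm_pow_stdGaussian]
        simp only [finrank_euclideanSpace, Fintype.card_fin, prod_range_succ, prod_range_zero]
        norm_num
        ring
    _ ≤ 2 * ((n + 4) * ‖gradient f x‖ ^ 2)
          + μ ^ 2 * L ^ 2 / 2 * ((n + 4) * (n + 4) * (n + 4)) := by
        gcongr <;> linarith
    _ = _ := by ring

theorem integrable_inner_mul_diffQuotient (hf : IsC11 L f) (hμ : 0 < μ) (x v : E n) :
    Integrable (fun u => ⟪v, u⟫ * diffQuotient f μ x u) (stdGaussian (E n)) := by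
  refine Integrable.mono'
    (((integrable_norm_pow_stdGaussian 2).const_mul (‖v‖ * ‖gradient f x‖)).add
      ((integrable_norm_pow_stdGaussian 3).const_mul (‖v‖ * (μ * L / 2))))
    ((continuous_const.inner continuous_id).mul
      (hf.continuous_diffQuotient x)).aestronglyMeasurable (.of_forall fun u => ?_)
  rw [norm_mul, Real.norm_eq_abs, Real.norm_eq_abs]
  calc |⟪v, u⟫| * |diffQuotient f μ x u|
      ≤ (‖v‖ * ‖u‖) * (‖gradient f x‖ * ‖u‖ + μ * L / 2 * ‖u‖ ^ 2) :=
        mul_le_mul (abs_real_inner_le_norm _ _) (hf.abs_diffQuotient_le hμ x u) (abs_nonneg _)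
          (by positivity)
    _ = _ := by simp only [Pi.add_apply]; ring

theorem le_integral_inner_gradient_mul_diffQuotient (hf : IsC11 L f) (hμ : 0 < μ) (x : E n) :
    ‖gradient f x‖ ^ 2 / 2 - μ ^ 2 * L ^ 2 / 8 * (n + 4) ^ 2
      ≤ ∫ u, ⟪gradient f x, u⟫ * diffQuotient f μ x u ∂stdGaussian (E n) := by
  have hquad :=
    (integrable_inner_sq_mul_norm_pow_stdGaussian (gradient f x) (2 * 0)).const_mul (1 / 2)
  have hfour := (integrable_norm_pow_stdGaussian (V := E n) (2 * 2)).const_mul (μ ^ 2 * L ^ 2 / 8)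
  calc ‖gradient f x‖ ^ 2 / 2 - μ ^ 2 * L ^ 2 / 8 * (n + 4) ^ 2
      ≤ ‖gradient f x‖ ^ 2 / 2 - μ ^ 2 * L ^ 2 / 8 * (n * (n + 2)) := by
        gcongr; nlinarith
    _ = ∫ u, (1 / 2 * (⟪gradient f x, u⟫ ^ 2 * ‖u‖ ^ (2 * 0))
          - μ ^ 2 * L ^ 2 / 8 * ‖u‖ ^ (2 * 2)) ∂stdGaussian (E n) := by
        rw [integral_sub hquad hfour, integral_const_mul, integral_const_mul,
          integral_inner_sq_mul_norm_pow_stdGaussian, integral_norm_pow_stdGaussian]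
        simp only [finrank_euclideanSpace, Fintype.card_fin, prod_range_succ, prod_range_zero]
        norm_num
        ring
    _ ≤ _ := by
        refine integral_mono (hquad.sub hfour) (hf.integrable_inner_mul_diffQuotient hμ x _)
          fun u => ?_
        dsimp only
        nlinarith [hf.sq_diffQuotient_sub_inner_le hμ x u, sq_nonneg (diffQuotient f μ x u)]

theorem hasFDerivAt_diffQuotient (hf : IsC11 L f) (hμ : μ ≠ 0) (x u : E n) :
    HasFDerivAt (diffQuotient f μ x)
      (InnerProductSpace.toDual ℝ (E n) (gradient f (x + μ • u))) u := by
  have hshift : HasFDerivAt (fun u : E n => x + μ • u) (μ • ContinuousLinearMap.id ℝ (E n)) u :=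
    ((hasFDerivAt_id u).const_smul μ).const_add x
  have hcomp := (((hf.hasGradientAt (x + μ • u)).hasFDerivAt.comp u hshift).sub_const
    (f x)).mul_const μ⁻¹
  refine hcomp.congr_fderiv ?_
  ext w
  simp [hμ]

theorem norm_gradient_add_smul_le (hf : IsC11 L f) (hμ : 0 < μ) (x u : E n) :
    ‖gradient f (x + μ • u)‖ ≤ ‖gradient f x‖ + μ * L * ‖u‖ := by
  refine (hf.norm_gradient_le x _).trans_eq ?_
  rw [add_sub_cancel_left, norm_smul, Real.norm_of_nonneg hμ.le]
  ring

theorem integral_inner_mul_diffQuotient (hf : IsC11 L f) (hL : 0 ≤ L) (hμ : 0 < μ) (x v : E n) :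
    ∫ u, ⟪v, u⟫ * diffQuotient f μ x u ∂stdGaussian (E n)
      = ∫ u, ⟪gradient f (x + μ • u), v⟫ ∂stdGaussian (E n) := by
  have hderiv := hf.hasFDerivAt_diffQuotient hμ.ne' x
  have hμL : 0 ≤ μ * L := by positivity
  have hstein := integral_mul_inner_stdGaussian (f := diffQuotient f μ x)
    (C := ‖gradient f x‖ + μ * L) (p := 2) (fun u => (hderiv u).differentiableAt)
    (fun u => ?_) (fun u => ?_) v
  · simpa only [(hderiv _).fderiv, InnerProductSpace.toDual_apply_apply, mul_comm] using hstein
  · calc |diffQuotient f μ x u| ≤ ‖gradient f x‖ * ‖u‖ + μ * L / 2 * ‖u‖ ^ 2 :=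
          hf.abs_diffQuotient_le hμ x u
      _ ≤ ‖gradient f x‖ * (1 + ‖u‖) ^ 2 + μ * L * (1 + ‖u‖) ^ 2 := by
          gcongr <;> nlinarith [norm_nonneg u]
      _ = _ := by ring
  · rw [(hderiv u).fderiv, LinearIsometryEquiv.norm_map]
    calc ‖gradient f (x + μ • u)‖ ≤ ‖gradient f x‖ * 1 + μ * L * ‖u‖ := by
          rw [mul_one]; exact hf.norm_gradient_add_smul_le hμ x u
      _ ≤ ‖gradient f x‖ * (1 + ‖u‖) ^ 2 + μ * L * (1 + ‖u‖) ^ 2 := by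
          gcongr <;> nlinarith [norm_nonneg u]
      _ = _ := by ring

theorem integrable_inner_gradient_add_smul (hf : IsC11 L f) (hμ : 0 < μ) (x v : E n) :
    Integrable (fun u => ⟪gradient f (x + μ • u), v⟫) (stdGaussian (E n)) := by
  have hgrad := hf.continuous_gradient
  refine Integrable.mono' (((integrable_const ‖gradient f x‖).add
    ((integrable_norm_pow_stdGaussian 1).const_mul (μ * L))).mul_const ‖v‖)
    (Continuous.aestronglyMeasurable (by fun_prop)) (.of_forall fun u => ?_)
  refine (norm_inner_le_norm _ _).trans ?_
  gcongr
  simpa using hf.norm_gradient_add_smul_le hμ x u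

theorem sub_add_le_inner_gradient_add_smul (hf : IsC11 L f) (hμ : 0 < μ)
    (hconv : ConvexOn ℝ Set.univ f) {y : E n} (hy : IsMinOn f Set.univ y) (x u : E n) :
    f x - f y + μ * ⟪gradient f x, u⟫ - μ ^ 2 * L / 2 * ‖u‖ ^ 2
      ≤ ⟪gradient f (x + μ • u), x - y⟫ := by
  have htangent_shift := hf.inner_le_of_convexOn hconv (x + μ • u) (y + μ • u)
  have htangent := hf.inner_le_of_convexOn hconv x (x + μ • u)
  have hsmooth := hf.le_add_inner y (μ • u)
  rw [gradient_eq_zero_of_isLocalMin (hy.isLocalMin Filter.univ_mem), inner_zero_left, norm_smul,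
    Real.norm_of_nonneg hμ.le] at hsmooth
  rw [add_sub_cancel_left, real_inner_smul_right] at htangent
  rw [add_sub_add_right_eq_sub, ← neg_sub x y, inner_neg_right] at htangent_shift
  linarith

theorem le_integral_inner_sub_mul_diffQuotient (hf : IsC11 L f) (hL : 0 ≤ L) (hμ : 0 < μ)
    (hconv : ConvexOn ℝ Set.univ f) {y : E n} (hy : IsMinOn f Set.univ y) (x : E n) :
    f x - f y - μ ^ 2 * L / 2 * (n + 4)
      ≤ ∫ u, ⟪x - y, u⟫ * diffQuotient f μ x u ∂stdGaussian (E n) := by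
  rw [hf.integral_inner_mul_diffQuotient hL hμ]
  have hlin : Integrable (fun u => μ * ⟪gradient f x, u⟫) (stdGaussian (E n)) :=
    (integrable_inner_stdGaussian _).const_mul _
  have haffine : Integrable (fun u => f x - f y + μ * ⟪gradient f x, u⟫) (stdGaussian (E n)) :=
    (integrable_const _).add hlin
  have hquad := (integrable_norm_pow_stdGaussian (V := E n) (2 * 1)).const_mul (μ ^ 2 * L / 2)
  calc f x - f y - μ ^ 2 * L / 2 * (n + 4) ≤ f x - f y - μ ^ 2 * L / 2 * n := by
        gcongr; linarith
    _ = ∫ u, (f x - f y + μ * ⟪gradient f x, u⟫ - μ ^ 2 * L / 2 * ‖u‖ ^ (2 * 1))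
          ∂stdGaussian (E n) := by
        rw [integral_sub haffine hquad,
          integral_add (integrable_const _) hlin, integral_const_mul, integral_const_mul,
          integral_inner_stdGaussian, integral_norm_pow_stdGaussian]
        simp
    _ ≤ _ := integral_mono (haffine.sub hquad)
        (hf.integrable_inner_gradient_add_smul hμ x _)
        (hf.sub_add_le_inner_gradient_add_smul hμ hconv hy x)

end IsC11

section Freezing

variable {Ω V H : Type*}

variable {m m0 : MeasurableSpace Ω} {Pr : Measure[m0] Ω}

section FiniteRange

variable {T : V → Ω → ℝ} {S : Ω → V} {t : Finset V}

theorem integrable_comp_of_finite_range (hSt : ∀ᵐ ω ∂Pr, S ω ∈ t)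
    (hS : ∀ a ∈ t, MeasurableSet (S ⁻¹' {a})) (hT : ∀ a ∈ t, Integrable (T a) Pr) :
    Integrable (fun ω => T (S ω) ω) Pr := by
  rw [← Measure.restrict_eq_self_of_ae_mem (s := S ⁻¹' t) hSt, ← Set.biUnion_preimage_singleton]
  exact integrableOn_finset_iUnion.2 fun a ha =>
    (hT a ha).integrableOn.congr_fun (fun ω hω => congrArg (T · ω) hω.symm) (hS a ha)

theorem integral_comp_of_finite_range (hSt : ∀ᵐ ω ∂Pr, S ω ∈ t)
    (hS : ∀ a ∈ t, MeasurableSet (S ⁻¹' {a})) (hT : ∀ a ∈ t, Integrable (T a) Pr) :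
    ∫ ω, T (S ω) ω ∂Pr = ∑ a ∈ t, ∫ ω in S ⁻¹' {a}, T a ω ∂Pr := by
  rw [integral_eq_setIntegral (s := S ⁻¹' t) hSt, ← Set.biUnion_preimage_singleton]
  refine (integral_biUnion_finset t hS
    (fun a _ b _ hab => (Set.disjoint_singleton.2 hab).preimage S)
    (fun a _ => (integrable_comp_of_finite_range hSt hS hT).integrableOn)).trans ?_
  exact sum_congr rfl fun a ha => setIntegral_congr_fun (hS a ha) fun ω hω => congrArg (T · ω) hω

theorem integral_comp_le_of_finite_range [IsProbabilityMeasure Pr] (hm : m ≤ m0)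
    (hSt : ∀ᵐ ω ∂Pr, S ω ∈ t) (hS : ∀ a ∈ t, MeasurableSet[m] (S ⁻¹' {a}))
    (hT : ∀ a ∈ t, Integrable (T a) Pr) {κ : ℝ}
    (hκ : ∀ a ∈ t, Pr[T a | m] ≤ᵐ[Pr] fun _ => κ) : ∫ ω, T (S ω) ω ∂Pr ≤ κ :=
  calc ∫ ω, T (S ω) ω ∂Pr = ∑ a ∈ t, ∫ ω in S ⁻¹' {a}, T a ω ∂Pr :=
        integral_comp_of_finite_range hSt (fun a ha => hm _ (hS a ha)) hT
    _ ≤ ∑ a ∈ t, ∫ _ω in S ⁻¹' {a}, κ ∂Pr := sum_le_sum fun a ha => by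
        rw [← setIntegral_condExp hm (hT a ha) (hS a ha)]
        exact setIntegral_mono_ae integrable_condExp.integrableOn
          (integrable_const κ).integrableOn (hκ a ha)
    _ = ∫ _, κ ∂Pr := (integral_comp_of_finite_range (T := fun _ _ => κ) hSt
        (fun a ha => hm _ (hS a ha)) fun _ _ => integrable_const κ).symm
    _ = κ := by simp

end FiniteRange

variable [NormedAddCommGroup V]

theorem exists_finite_range_tendsto_norm_le [MeasurableSpace V] [BorelSpace V]
    [SecondCountableTopology V] {mΩ : MeasurableSpace Ω} {X : Ω → V} (hX : Measurable X) :
    ∃ (S : ℕ → Ω → V) (t : ℕ → Finset V), (∀ j ω, S j ω ∈ t j) ∧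
      (∀ j a, MeasurableSet (S j ⁻¹' {a})) ∧ (∀ ω, Tendsto (S · ω) atTop (𝓝 (X ω))) ∧
      ∀ j ω, ‖S j ω‖ ≤ 2 * ‖X ω‖ := by
  let S := SimpleFunc.approxOn X hX Set.univ 0 (Set.mem_univ 0)
  refine ⟨fun j => S j, fun j => (S j).range, fun j => (S j).mem_range_self,
    fun j => (S j).measurableSet_fiber,
    fun ω => SimpleFunc.tendsto_approxOn _ _ (by simp), fun j ω => ?_⟩
  rw [two_mul]
  exact SimpleFunc.norm_approxOn_zero_le hX (Set.mem_univ 0) ω j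

section RealField

variable {T : V → Ω → ℝ}

/- `X` is approximated by simple functions, on whose level sets the field is evaluated at
deterministic points; dominated convergence passes to the limit. -/
theorem integral_comp_le_of_condExp_le [IsProbabilityMeasure Pr] [MeasurableSpace V]
    [BorelSpace V] [SecondCountableTopology V] (hm : m ≤ m0) {X : Ω → V} (hX : Measurable[m] X)
    (hT : ∀ a, Integrable (T a) Pr) (hcont : ∀ᵐ ω ∂Pr, Continuous fun a => T a ω) {B : Ω → ℝ}
    (hB : Integrable B Pr) (hTB : ∀ᵐ ω ∂Pr, ∀ a, ‖a‖ ≤ 2 * ‖X ω‖ → ‖T a ω‖ ≤ B ω) {κ : ℝ}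
    (hκ : ∀ a, Pr[T a | m] ≤ᵐ[Pr] fun _ => κ) :
    Integrable (fun ω => T (X ω) ω) Pr ∧ ∫ ω, T (X ω) ω ∂Pr ≤ κ := by
  obtain ⟨S, t, hSt, hS, hS_lim, hS_norm⟩ := exists_finite_range_tendsto_norm_le hX
  have hS_meas (j : ℕ) : AEStronglyMeasurable (fun ω => T (S j ω) ω) Pr :=
    (integrable_comp_of_finite_range (.of_forall (hSt j)) (fun a _ => hm _ (hS j a))
      fun a _ => hT a).aestronglyMeasurable
  have hlim : ∀ᵐ ω ∂Pr, Tendsto (fun j => T (S j ω) ω) atTop (𝓝 (T (X ω) ω)) := by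
    filter_upwards [hcont] with ω hω using (hω.tendsto (X ω)).comp (hS_lim ω)
  have hS_bound (j : ℕ) : ∀ᵐ ω ∂Pr, ‖T (S j ω) ω‖ ≤ B ω := by
    filter_upwards [hTB] with ω hω using hω _ (hS_norm j ω)
  constructor
  · refine hB.mono' (aestronglyMeasurable_of_tendsto_ae atTop hS_meas hlim) ?_
    filter_upwards [hTB] with ω hω using hω _ (by linarith [norm_nonneg (X ω)])
  · exact le_of_tendsto' (tendsto_integral_of_dominated_convergence B hS_meas hB hS_bound hlim)
      fun j => integral_comp_le_of_finite_range hm (.of_forall (hSt j)) (fun a _ => hS j a)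
        (fun a _ => hT a) fun a _ => hκ a

theorem integral_comp_eq_zero_of_condExp_eq_zero [IsProbabilityMeasure Pr] [MeasurableSpace V]
    [BorelSpace V] [SecondCountableTopology V] (hm : m ≤ m0) {X : Ω → V} (hX : Measurable[m] X)
    (hT : ∀ a, Integrable (T a) Pr) (hcont : ∀ᵐ ω ∂Pr, Continuous fun a => T a ω) {B : Ω → ℝ}
    (hB : Integrable B Pr) (hTB : ∀ᵐ ω ∂Pr, ∀ a, ‖a‖ ≤ 2 * ‖X ω‖ → ‖T a ω‖ ≤ B ω)
    (hzero : ∀ a, Pr[T a | m] =ᵐ[Pr] 0) :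
    Integrable (fun ω => T (X ω) ω) Pr ∧ ∫ ω, T (X ω) ω ∂Pr = 0 := by
  have hneg (a : V) : Pr[fun ω => -T a ω | m] ≤ᵐ[Pr] fun _ => 0 := by
    filter_upwards [condExp_neg (T a) m (μ := Pr), hzero a] with ω hω hω₀
    exact (hω.trans (by simp [hω₀])).le
  obtain ⟨hint, hle⟩ :=
    integral_comp_le_of_condExp_le (κ := 0) hm hX hT hcont hB hTB fun a => (hzero a).le
  have hge := (integral_comp_le_of_condExp_le (T := fun a ω => -T a ω) hm hX
    (fun a => (hT a).neg) (hcont.mono fun _ h => h.neg) hB (by simpa only [norm_neg] using hTB)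
    hneg).2
  rw [integral_neg] at hge
  exact ⟨hint, by linarith⟩

end RealField

variable [NormedAddCommGroup H]

theorem norm_le_of_lipschitzWith {z : V → H} {K : NNReal} (hz : LipschitzWith K z) {a : V} {r : ℝ}
    (ha : ‖a‖ ≤ r) : ‖z a‖ ≤ ‖z 0‖ + K * r :=
  calc ‖z a‖ ≤ ‖z 0‖ + ‖z a - z 0‖ := norm_le_norm_add_norm_sub' _ _
    _ ≤ ‖z 0‖ + K * ‖a - 0‖ := by gcongr; exact hz.norm_sub_le a 0
    _ ≤ ‖z 0‖ + K * r := by rw [sub_zero]; gcongr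

theorem integrable_inner_of_memLp_two [InnerProductSpace ℝ H] {c D : Ω → H}
    (hc : MemLp c 2 Pr) (hD : MemLp D 2 Pr) :
    Integrable (fun ω => ⟪c ω, D ω⟫) Pr :=
  (hc.norm.integrable_mul hD.norm).mono' (hc.aestronglyMeasurable.inner hD.aestronglyMeasurable)
    (.of_forall fun _ => norm_inner_le_norm _ _)

variable [IsProbabilityMeasure Pr] [MeasurableSpace V] [BorelSpace V] [SecondCountableTopology V]
  {Z : V → Ω → H} {K : NNReal} {X : Ω → V}

theorem integral_sq_norm_comp_le (hm : m ≤ m0) (hX : Measurable[m] X) (hX2 : MemLp X 2 Pr)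
    (hZ : ∀ a, MemLp (Z a) 2 Pr) (hlip : ∀ᵐ ω ∂Pr, LipschitzWith K fun a => Z a ω) {κ : ℝ}
    (hκ : ∀ a, Pr[fun ω => ‖Z a ω‖ ^ 2 | m] ≤ᵐ[Pr] fun _ => κ) :
    Integrable (fun ω => ‖Z (X ω) ω‖ ^ 2) Pr ∧ ∫ ω, ‖Z (X ω) ω‖ ^ 2 ∂Pr ≤ κ := by
  have hbound : MemLp (fun ω => ‖Z 0 ω‖ + K * (2 * ‖X ω‖)) 2 Pr :=
    (hZ 0).norm.add ((hX2.norm.const_mul 2).const_mul _)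
  refine integral_comp_le_of_condExp_le (T := fun a ω => ‖Z a ω‖ ^ 2) hm hX
    (fun a => (hZ a).integrable_norm_pow two_ne_zero)
    (hlip.mono fun _ h => h.continuous.norm.pow 2) hbound.integrable_sq ?_ hκ
  filter_upwards [hlip] with ω hω a ha
  rw [norm_pow, norm_norm]
  gcongr
  exact norm_le_of_lipschitzWith hω ha

variable [InnerProductSpace ℝ H]

theorem condExp_inner_eq_zero [CompleteSpace H] {c D : Ω → H} (hc : StronglyMeasurable[m] c)
    (hc2 : MemLp c 2 Pr) (hD2 : MemLp D 2 Pr) (hD : Pr[D | m] =ᵐ[Pr] 0) :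
    Pr[fun ω => ⟪c ω, D ω⟫ | m] =ᵐ[Pr] 0 := by
  have hpull := condExp_bilin_of_stronglyMeasurable_left (innerSL ℝ) hc
    (integrable_inner_of_memLp_two hc2 hD2) (hD2.integrable one_le_two)
  filter_upwards [hpull, hD] with ω hω hDω
  rwa [hDω, Pi.zero_apply, map_zero] at hω

theorem integral_inner_comp_eq_zero [CompleteSpace H] (hm : m ≤ m0) (hX : Measurable[m] X)
    (hX2 : MemLp X 2 Pr) (hZ2 : ∀ a, MemLp (Z a) 2 Pr)
    (hlip : ∀ᵐ ω ∂Pr, LipschitzWith K fun a => Z a ω) (hZ : ∀ a, Pr[Z a | m] =ᵐ[Pr] 0)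
    {c : Ω → H} (hc : StronglyMeasurable[m] c) (hc2 : MemLp c 2 Pr) :
    Integrable (fun ω => ⟪c ω, Z (X ω) ω⟫) Pr ∧ ∫ ω, ⟪c ω, Z (X ω) ω⟫ ∂Pr = 0 := by
  have hbound : MemLp (fun ω => ‖Z 0 ω‖ + K * (2 * ‖X ω‖)) 2 Pr :=
    (hZ2 0).norm.add ((hX2.norm.const_mul 2).const_mul _)
  refine integral_comp_eq_zero_of_condExp_eq_zero (T := fun a ω => ⟪c ω, Z a ω⟫) hm hX
    (fun a => integrable_inner_of_memLp_two hc2 (hZ2 a))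
    (hlip.mono fun _ h => continuous_const.inner h.continuous)
    (hc2.norm.integrable_mul hbound) ?_ fun a => condExp_inner_eq_zero hc hc2 (hZ2 a) (hZ a)
  filter_upwards [hlip] with ω hω a ha
  refine (norm_inner_le_norm _ _).trans ?_
  simp only [Pi.mul_apply]
  gcongr
  exact norm_le_of_lipschitzWith hω ha

end Freezing

section Independence

variable {Ω α β : Type*} [MeasurableSpace Ω] [MeasurableSpace α] [MeasurableSpace β]
  {Pr : Measure Ω} [IsFiniteMeasure Pr] {U : Ω → α} {Y : Ω → β}

theorem map_prodMk_of_indepFun (hU : Measurable U) (hY : Measurable Y) (hUY : IndepFun U Y Pr) :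
    Pr.map (fun ω => (U ω, Y ω)) = ((Pr.map U).prod Pr).map (Prod.map id Y) := by
  rw [(indepFun_iff_map_prod_eq_prod_map_map hU.aemeasurable hY.aemeasurable).1 hUY,
    ← Measure.map_prod_map _ _ measurable_id hY, Measure.map_id]

variable {g : α × β → ℝ}

theorem integrable_prod_iff_of_indepFun (hU : Measurable U) (hY : Measurable Y)
    (hUY : IndepFun U Y Pr) (hg : Measurable g) :
    Integrable (fun ω => g (U ω, Y ω)) Pr
      ↔ Integrable (fun z => g (z.1, Y z.2)) ((Pr.map U).prod Pr) := by
  have hmap := map_prodMk_of_indepFun hU hY hUY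
  exact (integrable_map_measure hg.aestronglyMeasurable (hU.prodMk hY).aemeasurable).symm.trans
    (hmap ▸ integrable_map_measure hg.aestronglyMeasurable (measurable_id.prodMap hY).aemeasurable)

theorem integral_eq_integral_prod_of_indepFun (hU : Measurable U) (hY : Measurable Y)
    (hUY : IndepFun U Y Pr) (hg : Measurable g) :
    ∫ ω, g (U ω, Y ω) ∂Pr = ∫ z, g (z.1, Y z.2) ∂(Pr.map U).prod Pr := by
  have hmap := map_prodMk_of_indepFun hU hY hUY
  exact (integral_map (hU.prodMk hY).aemeasurable hg.aestronglyMeasurable).symm.trans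
    (hmap ▸ integral_map (measurable_id.prodMap hY).aemeasurable hg.aestronglyMeasurable)

end Independence

theorem condExp_sub_const_eq_zero {Ω H : Type*} {m m0 : MeasurableSpace Ω} {Pr : Measure[m0] Ω}
    [IsFiniteMeasure Pr] [NormedAddCommGroup H] [NormedSpace ℝ H] [CompleteSpace H] (hm : m ≤ m0)
    {g : Ω → H} {c : H} (hg : Integrable g Pr) (hgc : Pr[g | m] =ᵐ[Pr] fun _ => c) :
    Pr[fun ω => g ω - c | m] =ᵐ[Pr] 0 := by
  filter_upwards [condExp_sub hg (integrable_const c) m, hgc] with ω hsub hω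
  rw [condExp_const hm, Pi.sub_apply, hω, sub_self] at hsub
  exact hsub

theorem measurable_gradFree {n : ℕ} {Ξ : Type*} [MeasurableSpace Ξ] {F : E n → Ξ → ℝ}
    (hF : Measurable (Function.uncurry F)) (μ : ℝ) :
    Measurable fun p : E n × (Ξ × E n) => gradFree F μ p.2.2 p.2.1 p.1 := by
  have hshift : Measurable fun p : E n × (Ξ × E n) => F (p.2.2 + μ • p.1) p.2.1 :=
    hF.comp (f := fun p : E n × (Ξ × E n) => (p.2.2 + μ • p.1, p.2.1)) (by fun_prop)
  have hbase : Measurable fun p : E n × (Ξ × E n) => F p.2.2 p.2.1 :=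
    hF.comp (f := fun p : E n × (Ξ × E n) => (p.2.2, p.2.1)) (by fun_prop)
  exact ((hshift.sub hbase).div_const μ).smul measurable_fst

section Expansion

variable {Ω : Type*} [MeasurableSpace Ω] {Pr : Measure Ω}

theorem integral_sq_norm_sub_smul {H : Type*} [NormedAddCommGroup H] [InnerProductSpace ℝ H]
    {X G : Ω → H} (hX : MemLp X 2 Pr) (hG : MemLp G 2 Pr) (γ : ℝ) :
    ∫ ω, ‖X ω - γ • G ω‖ ^ 2 ∂Pr
      = ∫ ω, ‖X ω‖ ^ 2 ∂Pr - 2 * γ * ∫ ω, ⟪X ω, G ω⟫ ∂Pr + γ ^ 2 * ∫ ω, ‖G ω‖ ^ 2 ∂Pr := by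
  have hX_int := hX.integrable_norm_pow two_ne_zero
  have hG_int := (hG.integrable_norm_pow two_ne_zero).const_mul (γ ^ 2)
  have hinner_int := (integrable_inner_of_memLp_two hX hG).const_mul (2 * γ)
  have hexpand (ω : Ω) : ‖X ω - γ • G ω‖ ^ 2
      = ‖X ω‖ ^ 2 - 2 * γ * ⟪X ω, G ω⟫ + γ ^ 2 * ‖G ω‖ ^ 2 := by
    rw [norm_sub_sq_real, real_inner_smul_right, norm_smul, mul_pow, Real.norm_eq_abs, sq_abs,
      mul_assoc]
  have hdiff_int : Integrable (fun ω => ‖X ω‖ ^ 2 - 2 * γ * ⟪X ω, G ω⟫) Pr :=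
    hX_int.sub hinner_int
  simp only [hexpand]
  rw [integral_add hdiff_int hG_int, integral_sub hX_int hinner_int,
    integral_const_mul, integral_const_mul]

theorem IsC11.integral_sub_smul_le [IsFiniteMeasure Pr] {n : ℕ} {L : ℝ} {f : E n → ℝ}
    (hf : IsC11 L f) {X G : Ω → E n} (hX : MemLp X 2 Pr) (hG : MemLp G 2 Pr) (γ : ℝ) :
    ∫ ω, f (X ω - γ • G ω) ∂Pr ≤ ∫ ω, f (X ω) ∂Pr - γ * ∫ ω, ⟪gradient f (X ω), G ω⟫ ∂Pr
      + L * γ ^ 2 / 2 * ∫ ω, ‖G ω‖ ^ 2 ∂Pr := by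
  have hG_int := (hG.integrable_norm_pow two_ne_zero).const_mul (L * γ ^ 2 / 2)
  have hf_int := hf.integrable_comp hX
  have hinner_int :=
    (integrable_inner_of_memLp_two (hf.memLp_gradient_comp hX) hG).const_mul γ
  have hdiff_int : Integrable (fun ω => f (X ω) - γ * ⟪gradient f (X ω), G ω⟫) Pr :=
    hf_int.sub hinner_int
  calc ∫ ω, f (X ω - γ • G ω) ∂Pr
      ≤ ∫ ω, (f (X ω) - γ * ⟪gradient f (X ω), G ω⟫ + L * γ ^ 2 / 2 * ‖G ω‖ ^ 2) ∂Pr := by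
        refine integral_mono (hf.integrable_comp (hX.sub (hG.const_smul γ)))
          (hdiff_int.add hG_int) fun ω => ?_
        have hdescent := hf.le_add_inner (X ω) (-(γ • G ω))
        rw [inner_neg_right, real_inner_smul_right, norm_neg, norm_smul, mul_pow,
          Real.norm_eq_abs, sq_abs, ← sub_eq_add_neg] at hdescent
        linarith
    _ = _ := by
        rw [integral_add hdiff_int hG_int, integral_sub hf_int hinner_int,
          integral_const_mul, integral_const_mul]

end Expansion

/-- One call of the stochastic zeroth-order oracle, with sample `s` and direction `w`, at a random
point `X` that depends on the past `m` only. -/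
structure IsOracleCall {n : ℕ} {Ω : Type u} {Ξ : Type v} (m : MeasurableSpace Ω)
    {m0 : MeasurableSpace Ω} [MeasurableSpace Ξ] (Pr : Measure Ω) (F : E n → Ξ → ℝ) (f : E n → ℝ)
    (L σ : ℝ) (s : Ω → Ξ) (w X : Ω → E n) : Prop where
  le : m ≤ m0
  nonneg : 0 ≤ L
  measurable : Measurable (Function.uncurry F)
  smooth : ∀ᵐ ω ∂Pr, IsC11 L (fun x => F x (s ω))
  isC11 : IsC11 L f
  measurable_sample : Measurable s
  measurable_dir : Measurable w
  measurable_point : Measurable[m] X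
  memLp_point : MemLp X 2 Pr
  integrable_value : ∀ x, Integrable (fun ω => F x (s ω)) Pr
  condExp_value : ∀ x, Pr[fun ω => F x (s ω) | m] =ᵐ[Pr] fun _ => f x
  integrable_grad : ∀ x, Integrable (fun ω => stochGrad F x (s ω)) Pr
  condExp_grad : ∀ x, Pr[fun ω => stochGrad F x (s ω) | m] =ᵐ[Pr] fun _ => gradient f x
  integrable_sq : ∀ x, Integrable (fun ω => ‖stochGrad F x (s ω) - gradient f x‖ ^ 2) Pr
  condExp_sq_le : ∀ x, Pr[fun ω => ‖stochGrad F x (s ω) - gradient f x‖ ^ 2 | m]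
    ≤ᵐ[Pr] fun _ => σ ^ 2
  map_dir : Pr.map w = stdGaussian (E n)
  indep : IndepFun w (fun ω => (s ω, X ω)) Pr

namespace IsOracleCall

variable {n : ℕ} {Ω : Type u} {Ξ : Type v} {m m0 : MeasurableSpace Ω} [MeasurableSpace Ξ]
  {Pr : Measure[m0] Ω} {F : E n → Ξ → ℝ} {f : E n → ℝ} {L σ μ : ℝ} {s : Ω → Ξ} {w X : Ω → E n}

theorem measurable_sample_point (h : IsOracleCall m Pr F f L σ s w X) :
    Measurable fun ω => (s ω, X ω) :=
  h.measurable_sample.prodMk (h.measurable_point.mono h.le le_rfl)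

theorem lipschitzWith_gradient_error (h : IsOracleCall m Pr F f L σ s w X) :
    ∀ᵐ ω ∂Pr, LipschitzWith (L + L).toNNReal
      fun a => stochGrad F a (s ω) - gradient f a := by
  filter_upwards [h.smooth] with ω hω
  refine LipschitzWith.of_dist_le_mul fun a b => ?_
  rw [dist_eq_norm, dist_eq_norm, Real.coe_toNNReal _ (add_nonneg h.nonneg h.nonneg)]
  simpa only [hω.gradient_sub h.isC11, stochGrad] using (hω.sub h.isC11).2 b a

theorem lipschitzWith_diffQuotient_error (h : IsOracleCall m Pr F f L σ s w X) (hμ : 0 < μ)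
    (u : E n) : ∀ᵐ ω ∂Pr, LipschitzWith ((L + L) * ‖u‖).toNNReal
      fun a => diffQuotient (fun x => F x (s ω) - f x) μ a u := by
  filter_upwards [h.smooth] with ω hω
  refine LipschitzWith.of_dist_le_mul fun a b => ?_
  rw [dist_eq_norm, dist_eq_norm, Real.coe_toNNReal _
    (mul_nonneg (add_nonneg h.nonneg h.nonneg) (norm_nonneg u))]
  exact (hω.sub h.isC11).abs_diffQuotient_sub_le hμ a b u

theorem integral_sq_norm_gradFree_dir_le (h : IsOracleCall m Pr F f L σ s w X) (hμ : 0 < μ) :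
    ∀ᵐ ω ∂Pr, ∫ u, ‖gradFree F μ (X ω) (s ω) u‖ ^ 2 ∂stdGaussian (E n)
      ≤ 2 * (n + 4) * ‖stochGrad F (X ω) (s ω)‖ ^ 2 + μ ^ 2 * L ^ 2 / 2 * (n + 4) ^ 3 := by
  filter_upwards [h.smooth] with ω hω using hω.integral_sq_norm_diffQuotient_smul_le hμ (X ω)

variable [IsProbabilityMeasure Pr]

theorem memLp_gradient_error (h : IsOracleCall m Pr F f L σ s w X) (a : E n) :
    MemLp (fun ω => stochGrad F a (s ω) - gradient f a) 2 Pr :=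
  (memLp_two_iff_integrable_sq_norm
    ((h.integrable_grad a).sub (integrable_const _)).aestronglyMeasurable).2 (h.integrable_sq a)

theorem memLp_diffQuotient_error (h : IsOracleCall m Pr F f L σ s w X) (hμ : 0 < μ) (a u : E n) :
    MemLp (fun ω => diffQuotient (fun x => F x (s ω) - f x) μ a u) 2 Pr := by
  have hbound : MemLp (fun ω => ‖stochGrad F a (s ω) - gradient f a‖ * ‖u‖
      + μ * (L + L) / 2 * ‖u‖ ^ 2) 2 Pr :=
    ((h.memLp_gradient_error a).norm.mul_const _).add (memLp_const _)
  refine hbound.mono' ((((h.integrable_value _).sub (integrable_const _)).sub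
    ((h.integrable_value a).sub (integrable_const _))).div_const μ).aestronglyMeasurable ?_
  filter_upwards [h.smooth] with ω hω
  simpa only [hω.gradient_sub h.isC11, stochGrad, Real.norm_eq_abs] using
    (hω.sub h.isC11).abs_diffQuotient_le hμ a u

theorem condExp_gradient_error (h : IsOracleCall m Pr F f L σ s w X) (a : E n) :
    Pr[fun ω => stochGrad F a (s ω) - gradient f a | m] =ᵐ[Pr] 0 :=
  condExp_sub_const_eq_zero h.le (h.integrable_grad a) (h.condExp_grad a)

theorem condExp_diffQuotient_error (h : IsOracleCall m Pr F f L σ s w X) (μ : ℝ) (a u : E n) :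
    Pr[fun ω => diffQuotient (fun x => F x (s ω) - f x) μ a u | m] =ᵐ[Pr] 0 := by
  have hint (b : E n) : Integrable (fun ω => F b (s ω) - f b) Pr :=
    (h.integrable_value b).sub (integrable_const _)
  have hzero (b : E n) : Pr[fun ω => F b (s ω) - f b | m] =ᵐ[Pr] 0 :=
    condExp_sub_const_eq_zero h.le (h.integrable_value b) (h.condExp_value b)
  have hdq : (fun ω => diffQuotient (fun x => F x (s ω) - f x) μ a u)
      = μ⁻¹ • ((fun ω => F (a + μ • u) (s ω) - f (a + μ • u)) - fun ω => F a (s ω) - f a) :=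
    funext fun ω => div_eq_inv_mul _ _
  rw [hdq]
  filter_upwards [condExp_smul μ⁻¹ ((fun ω => F (a + μ • u) (s ω) - f (a + μ • u))
      - fun ω => F a (s ω) - f a) m, condExp_sub (hint (a + μ • u)) (hint a) m,
    hzero (a + μ • u), hzero a] with ω hsmul hsub hshift hbase
  rw [hsmul, Pi.smul_apply, hsub, Pi.sub_apply, hshift, hbase, sub_self, smul_zero, Pi.zero_apply]

theorem integrable_sq_norm_gradient (h : IsOracleCall m Pr F f L σ s w X) :
    Integrable (fun ω => ‖gradient f (X ω)‖ ^ 2) Pr :=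
  (h.isC11.memLp_gradient_comp h.memLp_point).integrable_norm_pow two_ne_zero

theorem integral_sq_norm_stochGrad_le (h : IsOracleCall m Pr F f L σ s w X) :
    Integrable (fun ω => ‖stochGrad F (X ω) (s ω)‖ ^ 2) Pr ∧
      ∫ ω, ‖stochGrad F (X ω) (s ω)‖ ^ 2 ∂Pr ≤ ∫ ω, ‖gradient f (X ω)‖ ^ 2 ∂Pr + σ ^ 2 := by
  have hgrad := h.isC11.memLp_gradient_comp h.memLp_point
  obtain ⟨hvar_int, hvar⟩ := integral_sq_norm_comp_le h.le h.measurable_point h.memLp_point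
    h.memLp_gradient_error h.lipschitzWith_gradient_error h.condExp_sq_le
  obtain ⟨hcross_int, hcross⟩ := integral_inner_comp_eq_zero h.le h.measurable_point h.memLp_point
    h.memLp_gradient_error h.lipschitzWith_gradient_error h.condExp_gradient_error
    (c := fun ω => gradient f (X ω))
    (h.isC11.continuous_gradient.measurable.comp h.measurable_point).stronglyMeasurable hgrad
  have hexpand (ω : Ω) : ‖stochGrad F (X ω) (s ω)‖ ^ 2 = ‖gradient f (X ω)‖ ^ 2
      + 2 * ⟪gradient f (X ω), stochGrad F (X ω) (s ω) - gradient f (X ω)⟫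
      + ‖stochGrad F (X ω) (s ω) - gradient f (X ω)‖ ^ 2 := by
    rw [← norm_add_sq_real, add_sub_cancel]
  have hsum : Integrable (fun ω => ‖gradient f (X ω)‖ ^ 2
      + 2 * ⟪gradient f (X ω), stochGrad F (X ω) (s ω) - gradient f (X ω)⟫) Pr :=
    h.integrable_sq_norm_gradient.add (hcross_int.const_mul 2)
  simp only [hexpand]
  refine ⟨hsum.add hvar_int, ?_⟩
  calc _ = ∫ ω, ‖gradient f (X ω)‖ ^ 2 ∂Pr + 2 * 0
        + ∫ ω, ‖stochGrad F (X ω) (s ω) - gradient f (X ω)‖ ^ 2 ∂Pr := by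
        rw [integral_add hsum hvar_int, integral_add h.integrable_sq_norm_gradient
          (hcross_int.const_mul 2), integral_const_mul, hcross]
    _ ≤ _ := by linarith

theorem integrable_prod_sq_norm_gradFree (h : IsOracleCall m Pr F f L σ s w X) (hμ : 0 < μ) :
    Integrable (fun z : E n × Ω => ‖gradFree F μ (X z.2) (s z.2) z.1‖ ^ 2)
      ((stdGaussian (E n)).prod Pr) := by
  have hmeas : Measurable fun z : E n × Ω => ‖gradFree F μ (X z.2) (s z.2) z.1‖ ^ 2 :=
    ((measurable_gradFree h.measurable μ).norm.pow_const 2).comp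
      (f := fun z : E n × Ω => (z.1, (s z.2, X z.2)))
      (measurable_fst.prodMk (h.measurable_sample_point.comp measurable_snd))
  refine (integrable_prod_iff' hmeas.aestronglyMeasurable).2 ⟨?_, ?_⟩
  · filter_upwards [h.smooth] with ω hω using hω.integrable_sq_norm_diffQuotient_smul hμ (X ω)
  · refine Integrable.mono' ((h.integral_sq_norm_stochGrad_le.1.const_mul (2 * ((n : ℝ) + 4))).add
      (integrable_const (μ ^ 2 * L ^ 2 / 2 * ((n : ℝ) + 4) ^ 3)))
      hmeas.norm.stronglyMeasurable.integral_prod_left'.aestronglyMeasurable ?_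
    filter_upwards [h.integral_sq_norm_gradFree_dir_le hμ] with ω hω
    simp only [norm_pow, norm_norm]
    rwa [Real.norm_of_nonneg (integral_nonneg fun u => by positivity)]

theorem memLp_gradFree (h : IsOracleCall m Pr F f L σ s w X) (hμ : 0 < μ) :
    MemLp (fun ω => gradFree F μ (X ω) (s ω) (w ω)) 2 Pr := by
  have hmeas := (measurable_gradFree h.measurable μ).comp
    (h.measurable_dir.prodMk h.measurable_sample_point)
  refine (memLp_two_iff_integrable_sq_norm hmeas.aestronglyMeasurable).2 ?_
  refine (integrable_prod_iff_of_indepFun h.measurable_dir h.measurable_sample_point h.indep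
    ((measurable_gradFree h.measurable μ).norm.pow_const 2)).2 ?_
  rw [h.map_dir]
  exact h.integrable_prod_sq_norm_gradFree hμ

theorem integral_sq_norm_gradFree_le (h : IsOracleCall m Pr F f L σ s w X) (hμ : 0 < μ) :
    ∫ ω, ‖gradFree F μ (X ω) (s ω) (w ω)‖ ^ 2 ∂Pr
      ≤ 2 * (n + 4) * (∫ ω, ‖gradient f (X ω)‖ ^ 2 ∂Pr + σ ^ 2)
        + μ ^ 2 * L ^ 2 / 2 * (n + 4) ^ 3 := by
  have hprod := h.integrable_prod_sq_norm_gradFree hμ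
  obtain ⟨hgrad_int, hgrad⟩ := h.integral_sq_norm_stochGrad_le
  have hbound_int := hgrad_int.const_mul (2 * ((n : ℝ) + 4))
  calc ∫ ω, ‖gradFree F μ (X ω) (s ω) (w ω)‖ ^ 2 ∂Pr
      = ∫ z, ‖gradFree F μ (X z.2) (s z.2) z.1‖ ^ 2 ∂(stdGaussian (E n)).prod Pr := by
        rw [← h.map_dir]
        exact integral_eq_integral_prod_of_indepFun h.measurable_dir h.measurable_sample_point
          h.indep ((measurable_gradFree h.measurable μ).norm.pow_const 2)
    _ = ∫ ω, ∫ u, ‖gradFree F μ (X ω) (s ω) u‖ ^ 2 ∂stdGaussian (E n) ∂Pr :=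
        integral_prod_symm _ hprod
    _ ≤ ∫ ω, (2 * (n + 4) * ‖stochGrad F (X ω) (s ω)‖ ^ 2
          + μ ^ 2 * L ^ 2 / 2 * (n + 4) ^ 3) ∂Pr :=
        integral_mono_ae hprod.integral_prod_right (hbound_int.add (integrable_const _))
          (h.integral_sq_norm_gradFree_dir_le hμ)
    _ = 2 * (n + 4) * ∫ ω, ‖stochGrad F (X ω) (s ω)‖ ^ 2 ∂Pr
          + μ ^ 2 * L ^ 2 / 2 * (n + 4) ^ 3 := by
        rw [integral_add hbound_int (integrable_const _), integral_const_mul, integral_const,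
          probReal_univ, one_smul]
    _ ≤ _ := by gcongr

theorem integral_inner_mul_diffQuotient_error_eq_zero (h : IsOracleCall m Pr F f L σ s w X)
    (hμ : 0 < μ) {c : Ω → E n} (hc : StronglyMeasurable[m] c) (hc2 : MemLp c 2 Pr) (u : E n) :
    ∫ ω, ⟪c ω, u⟫ * diffQuotient (fun x => F x (s ω) - f x) μ (X ω) u ∂Pr = 0 := by
  simpa only [RCLike.inner_apply, conj_trivial, mul_comm] using
    (integral_inner_comp_eq_zero h.le h.measurable_point h.memLp_point
      (fun a => h.memLp_diffQuotient_error hμ a u) (h.lipschitzWith_diffQuotient_error hμ u)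
      (fun a => h.condExp_diffQuotient_error μ a u) (c := fun ω => ⟪c ω, u⟫)
      (hc.inner stronglyMeasurable_const) (hc2.inner_const u)).2

variable {φ : E n → E n}

theorem integrable_prod_inner_gradFree (h : IsOracleCall m Pr F f L σ s w X) (hμ : 0 < μ)
    (hφ : Measurable φ) (hφ2 : MemLp (fun ω => φ (X ω)) 2 Pr) :
    Integrable (fun z : E n × Ω => ⟪φ (X z.2), gradFree F μ (X z.2) (s z.2) z.1⟫)
      ((stdGaussian (E n)).prod Pr) := by
  have hmeas : Measurable fun p : E n × (Ξ × E n) => ⟪φ p.2.2, gradFree F μ p.2.2 p.2.1 p.1⟫ :=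
    (hφ.comp (measurable_snd.comp measurable_snd)).inner (measurable_gradFree h.measurable μ)
  rw [← h.map_dir]
  exact (integrable_prod_iff_of_indepFun h.measurable_dir h.measurable_sample_point h.indep
    hmeas).1 (integrable_inner_of_memLp_two hφ2 (h.memLp_gradFree hμ))

theorem integrable_prod_inner_mul_diffQuotient (h : IsOracleCall m Pr F f L σ s w X) (hμ : 0 < μ)
    (hφ : Measurable φ) (hφ2 : MemLp (fun ω => φ (X ω)) 2 Pr) :
    Integrable (fun z : E n × Ω => ⟪φ (X z.2), z.1⟫ * diffQuotient f μ (X z.2) z.1)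
      ((stdGaussian (E n)).prod Pr) := by
  have hX : Measurable fun z : E n × Ω => X z.2 := h.measurable_sample_point.snd.comp measurable_snd
  have hf := h.isC11.continuous.measurable
  have hdq : Measurable fun z : E n × Ω => diffQuotient f μ (X z.2) z.1 :=
    ((hf.comp (hX.add (measurable_fst.const_smul μ))).sub (hf.comp hX)).div_const μ
  have hbound := ((integrable_norm_pow_stdGaussian (V := E n) 2).mul_prod
    (hφ2.norm.integrable_mul (h.isC11.memLp_gradient_comp h.memLp_point).norm)).add
    (((integrable_norm_pow_stdGaussian (V := E n) 3).const_mul (μ * L / 2)).mul_prod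
      (hφ2.norm.integrable one_le_two))
  refine hbound.mono' (((hφ.comp hX).inner measurable_fst).mul hdq).aestronglyMeasurable
    (.of_forall fun z => ?_)
  rw [norm_mul, Real.norm_eq_abs, Real.norm_eq_abs]
  calc |⟪φ (X z.2), z.1⟫| * |diffQuotient f μ (X z.2) z.1|
      ≤ (‖φ (X z.2)‖ * ‖z.1‖) * (‖gradient f (X z.2)‖ * ‖z.1‖ + μ * L / 2 * ‖z.1‖ ^ 2) :=
        mul_le_mul (abs_real_inner_le_norm _ _) (h.isC11.abs_diffQuotient_le hμ _ _) (abs_nonneg _)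
          (by positivity)
    _ = _ := by simp only [Pi.add_apply, Pi.mul_apply]; ring

/- For a fixed direction the sampled and the true difference quotient have the same conditional
mean, so `F` may be replaced by `f` before averaging over the direction. -/
theorem integral_inner_gradFree (h : IsOracleCall m Pr F f L σ s w X) (hμ : 0 < μ)
    (hφ : Measurable φ) (hφ2 : MemLp (fun ω => φ (X ω)) 2 Pr) :
    ∫ ω, ⟪φ (X ω), gradFree F μ (X ω) (s ω) (w ω)⟫ ∂Pr
      = ∫ ω, ∫ u, ⟪φ (X ω), u⟫ * diffQuotient f μ (X ω) u ∂stdGaussian (E n) ∂Pr := by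
  have hmeas : Measurable fun p : E n × (Ξ × E n) => ⟪φ p.2.2, gradFree F μ p.2.2 p.2.1 p.1⟫ :=
    (hφ.comp (measurable_snd.comp measurable_snd)).inner (measurable_gradFree h.measurable μ)
  have hF := h.integrable_prod_inner_gradFree hμ hφ hφ2
  have hf := h.integrable_prod_inner_mul_diffQuotient hμ hφ hφ2
  have hdiff (u : E n) : ∫ ω, (⟪φ (X ω), gradFree F μ (X ω) (s ω) u⟫
      - ⟪φ (X ω), u⟫ * diffQuotient f μ (X ω) u) ∂Pr = 0 := by
    rw [← h.integral_inner_mul_diffQuotient_error_eq_zero hμ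
      (hφ.comp h.measurable_point).stronglyMeasurable hφ2 u]
    refine integral_congr_ae (.of_forall fun ω => ?_)
    simp only [gradFree, diffQuotient, real_inner_smul_right, Function.comp_apply]
    ring
  rw [integral_eq_integral_prod_of_indepFun h.measurable_dir h.measurable_sample_point h.indep
    hmeas, h.map_dir, ← integral_prod_symm _ hf, ← sub_eq_zero, ← integral_sub hF hf]
  exact (integral_prod _ (hF.sub hf)).trans (integral_eq_zero_of_ae (.of_forall hdiff))

theorem le_integral_inner_gradient_gradFree (h : IsOracleCall m Pr F f L σ s w X) (hμ : 0 < μ) :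
    (∫ ω, ‖gradient f (X ω)‖ ^ 2 ∂Pr) / 2 - μ ^ 2 * L ^ 2 / 8 * (n + 4) ^ 2
      ≤ ∫ ω, ⟪gradient f (X ω), gradFree F μ (X ω) (s ω) (w ω)⟫ ∂Pr := by
  have hφ := h.isC11.continuous_gradient.measurable
  have hφ2 := h.isC11.memLp_gradient_comp h.memLp_point
  have hint := h.integrable_sq_norm_gradient.div_const 2
  calc (∫ ω, ‖gradient f (X ω)‖ ^ 2 ∂Pr) / 2 - μ ^ 2 * L ^ 2 / 8 * (n + 4) ^ 2
      = ∫ ω, (‖gradient f (X ω)‖ ^ 2 / 2 - μ ^ 2 * L ^ 2 / 8 * (n + 4) ^ 2) ∂Pr := by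
        rw [integral_sub hint (integrable_const _), integral_div, integral_const, probReal_univ,
          one_smul]
    _ ≤ ∫ ω, ∫ u, ⟪gradient f (X ω), u⟫ * diffQuotient f μ (X ω) u ∂stdGaussian (E n) ∂Pr :=
        integral_mono (hint.sub (integrable_const _))
          (h.integrable_prod_inner_mul_diffQuotient hμ hφ hφ2).integral_prod_right
          fun ω => h.isC11.le_integral_inner_gradient_mul_diffQuotient hμ (X ω)
    _ = _ := (h.integral_inner_gradFree hμ hφ hφ2).symm

theorem le_integral_inner_sub_gradFree (h : IsOracleCall m Pr F f L σ s w X) (hμ : 0 < μ)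
    (hconv : ConvexOn ℝ Set.univ f) {y : E n} (hy : IsMinOn f Set.univ y) :
    ∫ ω, (f (X ω) - f y) ∂Pr - μ ^ 2 * L / 2 * (n + 4)
      ≤ ∫ ω, ⟪X ω - y, gradFree F μ (X ω) (s ω) (w ω)⟫ ∂Pr := by
  have hφ : Measurable fun x : E n => x - y := measurable_id.sub_const y
  have hφ2 : MemLp (fun ω => X ω - y) 2 Pr := h.memLp_point.sub (memLp_const y)
  have hint : Integrable (fun ω => f (X ω) - f y) Pr :=
    (h.isC11.integrable_comp h.memLp_point).sub (integrable_const _)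
  calc ∫ ω, (f (X ω) - f y) ∂Pr - μ ^ 2 * L / 2 * (n + 4)
      = ∫ ω, (f (X ω) - f y - μ ^ 2 * L / 2 * (n + 4)) ∂Pr := by
        rw [integral_sub hint (integrable_const _), integral_const, probReal_univ, one_smul]
    _ ≤ ∫ ω, ∫ u, ⟪X ω - y, u⟫ * diffQuotient f μ (X ω) u ∂stdGaussian (E n) ∂Pr :=
        integral_mono (hint.sub (integrable_const _))
          (h.integrable_prod_inner_mul_diffQuotient hμ hφ hφ2).integral_prod_right
          fun ω => h.isC11.le_integral_inner_sub_mul_diffQuotient h.nonneg hμ hconv hy (X ω)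
    _ = _ := (h.integral_inner_gradFree hμ hφ hφ2).symm

theorem memLp_update (h : IsOracleCall m Pr F f L σ s w X) (hμ : 0 < μ) (γ : ℝ) :
    MemLp (fun ω => X ω - γ • gradFree F μ (X ω) (s ω) (w ω)) 2 Pr :=
  h.memLp_point.sub ((h.memLp_gradFree hμ).const_smul γ)

variable {γ : ℝ}

theorem integral_update_add_le (h : IsOracleCall m Pr F f L σ s w X) (hμ : 0 < μ) (hγ : 0 ≤ γ)
    (hγL : 4 * L * (n + 4) * γ ≤ 1) :
    ∫ ω, f (X ω - γ • gradFree F μ (X ω) (s ω) (w ω)) ∂Pr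
        + γ / 4 * ∫ ω, ‖gradient f (X ω)‖ ^ 2 ∂Pr
      ≤ ∫ ω, f (X ω) ∂Pr
        + γ * (L * (n + 4) * σ ^ 2 * γ + μ ^ 2 * L ^ 2 * (n + 4) ^ 2 / 4) := by
  have hL := h.nonneg
  have hdescent := h.isC11.integral_sub_smul_le h.memLp_point (h.memLp_gradFree hμ) γ
  have hinner := mul_le_mul_of_nonneg_left (h.le_integral_inner_gradient_gradFree hμ) hγ
  have hsq := mul_le_mul_of_nonneg_left (h.integral_sq_norm_gradFree_le hμ)
    (by positivity : 0 ≤ L * γ ^ 2 / 2)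
  have hgrad : 4 * L * (n + 4) * γ * (γ * ∫ ω, ‖gradient f (X ω)‖ ^ 2 ∂Pr)
      ≤ γ * ∫ ω, ‖gradient f (X ω)‖ ^ 2 ∂Pr :=
    mul_le_of_le_one_left (mul_nonneg hγ (integral_nonneg fun ω => by positivity)) hγL
  have hbias : 4 * L * (n + 4) * γ * (γ * (μ ^ 2 * L ^ 2 * (n + 4) ^ 2))
      ≤ γ * (μ ^ 2 * L ^ 2 * (n + 4) ^ 2) :=
    mul_le_of_le_one_left (by positivity) hγL
  have hbias_nonneg : 0 ≤ γ * (μ ^ 2 * L ^ 2 * ((n : ℝ) + 4) ^ 2) := by positivity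
  linarith

theorem integral_sq_norm_update_sub_add_le (h : IsOracleCall m Pr F f L σ s w X) (hL : 0 < L)
    (hμ : 0 < μ) (hγ : 0 ≤ γ) (hγL : 4 * L * (n + 4) * γ ≤ 1) (hconv : ConvexOn ℝ Set.univ f)
    {y : E n} (hy : IsMinOn f Set.univ y) :
    ∫ ω, ‖X ω - γ • gradFree F μ (X ω) (s ω) (w ω) - y‖ ^ 2 ∂Pr
        + γ * ∫ ω, (f (X ω) - f y) ∂Pr
      ≤ ∫ ω, ‖X ω - y‖ ^ 2 ∂Pr
        + γ * (2 * (n + 4) * σ ^ 2 * γ + μ ^ 2 * L * (n + 4) ^ 2 / 2) := by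
  have hgap_int : Integrable (fun ω => f (X ω) - f y) Pr :=
    (h.isC11.integrable_comp h.memLp_point).sub (integrable_const _)
  have hgap_nonneg : 0 ≤ ∫ ω, (f (X ω) - f y) ∂Pr :=
    integral_nonneg fun ω => sub_nonneg.2 (isMinOn_univ_iff.1 hy (X ω))
  have hexpand := integral_sq_norm_sub_smul (h.memLp_point.sub (memLp_const y))
    (h.memLp_gradFree hμ) γ
  simp only [Pi.sub_apply, sub_right_comm _ y] at hexpand
  have hinner := mul_le_mul_of_nonneg_left (h.le_integral_inner_sub_gradFree hμ hconv hy) hγ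
  have hsq := mul_le_mul_of_nonneg_left (h.integral_sq_norm_gradFree_le hμ) (sq_nonneg γ)
  have hgrad : ∫ ω, ‖gradient f (X ω)‖ ^ 2 ∂Pr ≤ 2 * L * ∫ ω, (f (X ω) - f y) ∂Pr := by
    rw [← integral_const_mul]
    exact integral_mono h.integrable_sq_norm_gradient (hgap_int.const_mul _) fun ω =>
      h.isC11.sq_norm_gradient_le hL (isMinOn_univ_iff.1 hy) (X ω)
  have hgrad_scaled := mul_le_mul_of_nonneg_left hgrad
    (by positivity : 0 ≤ γ ^ 2 * (2 * ((n : ℝ) + 4)))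
  have hgap : 4 * L * (n + 4) * γ * (γ * ∫ ω, (f (X ω) - f y) ∂Pr)
      ≤ γ * ∫ ω, (f (X ω) - f y) ∂Pr :=
    mul_le_of_le_one_left (mul_nonneg hγ hgap_nonneg) hγL
  have hbias : 4 * L * (n + 4) * γ * (γ * (μ ^ 2 * L * (n + 4) ^ 2))
      ≤ γ * (μ ^ 2 * L * (n + 4) ^ 2) :=
    mul_le_of_le_one_left (by positivity) hγL
  have hdim : γ * (μ ^ 2 * L) * (4 * (n + 4)) ≤ γ * (μ ^ 2 * L) * (n + 4) ^ 2 :=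
    mul_le_mul_of_nonneg_left (by nlinarith [n.cast_nonneg (α := ℝ)]) (by positivity)
  have hbias_nonneg : 0 ≤ γ * (μ ^ 2 * L * ((n : ℝ) + 4) ^ 2) := by positivity
  linarith

end IsOracleCall

section RandomIndex

variable {Ω ι : Type*} [MeasurableSpace Ω] {Pr : Measure Ω} [IsProbabilityMeasure Pr]
  [MeasurableSpace ι] [MeasurableSingletonClass ι] {R : Ω → ι} {s : Finset ι}

theorem ae_mem_of_sum_measureReal_preimage_singleton (hR : Measurable R)
    (hs : ∑ k ∈ s, Pr.real (R ⁻¹' {k}) = 1) : ∀ᵐ ω ∂Pr, R ω ∈ s := by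
  rw [sum_measureReal_preimage_singleton s fun k _ => hR (measurableSet_singleton k),
    measureReal_def, ENNReal.toReal_eq_one_iff] at hs
  exact (mem_ae_iff_prob_eq_one (hR s.measurableSet)).2 hs

theorem integral_comp_index_of_indepFun (hR : Measurable R)
    (hs : ∑ k ∈ s, Pr.real (R ⁻¹' {k}) = 1) {Z : ι → Ω → ℝ}
    (hZ : ∀ k ∈ s, Integrable (Z k) Pr) (hRZ : ∀ k ∈ s, IndepFun R (Z k) Pr) :
    Integrable (fun ω => Z (R ω) ω) Pr ∧
      ∫ ω, Z (R ω) ω ∂Pr = ∑ k ∈ s, Pr.real (R ⁻¹' {k}) * ∫ ω, Z k ω ∂Pr := by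
  have hmem := ae_mem_of_sum_measureReal_preimage_singleton hR hs
  have hlevel : ∀ k ∈ s, MeasurableSet (R ⁻¹' {k}) := fun k _ => hR (measurableSet_singleton k)
  refine ⟨integrable_comp_of_finite_range hmem hlevel hZ,
    (integral_comp_of_finite_range hmem hlevel hZ).trans (sum_congr rfl fun k hk => ?_)⟩
  exact Indep.setIntegral_eq_mul (f := id) hR.comap_le (hRZ k hk) (hZ k hk).aemeasurable
    ⟨{k}, measurableSet_singleton k, rfl⟩ measurable_id.aestronglyMeasurable

end RandomIndex

theorem indepFun_of_measurable_comap {Ω α β δ : Type*} [MeasurableSpace Ω] [MeasurableSpace α]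
    [MeasurableSpace β] [MeasurableSpace δ] {Pr : Measure Ω} {U : Ω → α} {Y : Ω → β} {Z : Ω → δ}
    (hUY : IndepFun U Y Pr) (hZ : Measurable[MeasurableSpace.comap Y inferInstance] Z) :
    IndepFun U Z Pr :=
  indep_of_indep_of_le_right hUY hZ.comap_le

theorem add_mul_sum_Icc_le_of_step {a b : ℕ → ℝ} {c e : ℝ} (N : ℕ)
    (hstep : ∀ k ∈ Icc 1 N, a (k + 1) + c * b k ≤ a k + e) :
    a (N + 1) + c * ∑ k ∈ Icc 1 N, b k ≤ a 1 + N * e := by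
  induction N with
  | zero => simp
  | succ N ih =>
    have hprev := ih fun k hk => hstep k (Icc_subset_Icc_right N.le_succ hk)
    have hlast := hstep (N + 1) (right_mem_Icc.2 N.succ_pos)
    rw [sum_Icc_succ_top N.succ_pos]
    push_cast
    linarith

section History

variable {n : ℕ} {Ω : Type u} {Ξ : Type v} {ξ : ℕ → Ω → Ξ} {w : ℕ → Ω → E n}
  {F : E n → Ξ → ℝ} {γ : ℕ → ℝ} {μ : ℝ} {x₁ : E n} {k : ℕ}

theorem rsgfIterate_succ (hk : 1 ≤ k) (ω : Ω) :
    rsgfIterate F γ μ x₁ ξ w (k + 1) ω = rsgfIterate F γ μ x₁ ξ w k ω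
      - γ k • gradFree F μ (rsgfIterate F γ μ x₁ ξ w k ω) (ξ k ω) (w k ω) := by
  obtain ⟨j, rfl⟩ := Nat.exists_eq_add_of_le' hk
  rfl

variable [MeasurableSpace Ξ]

theorem measurable_history [MeasurableSpace Ω] (hξ : ∀ k, 1 ≤ k → Measurable (ξ k))
    (hw : ∀ k, 1 ≤ k → Measurable (w k)) : Measurable (history ξ w k) :=
  measurable_pi_lambda _ fun i =>
    (hξ i (mem_Ico.1 i.2).1).prodMk (hw i (mem_Ico.1 i.2).1)

theorem historySigma_mono {j : ℕ} (hjk : j ≤ k) : historySigma ξ w j ≤ historySigma ξ w k := by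
  have hrestrict : Measurable fun (z : Ico 1 k → Ξ × E n) (i : Ico 1 j) =>
      z ⟨i, Ico_subset_Ico_right hjk i.2⟩ :=
    measurable_pi_lambda _ fun i => measurable_pi_apply _
  exact (hrestrict.comp (comap_measurable (history ξ w k))).comap_le

theorem measurable_sample_historySigma (hk : 1 ≤ k) :
    Measurable[historySigma ξ w (k + 1)] fun ω => (ξ k ω, w k ω) :=
  (measurable_pi_apply (X := fun _ : Ico 1 (k + 1) => Ξ × E n)
    ⟨k, mem_Ico.2 ⟨hk, k.lt_succ_self⟩⟩).comp (comap_measurable (history ξ w (k + 1)))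

theorem measurable_rsgfIterate (hF : Measurable (Function.uncurry F)) (hk : 1 ≤ k) :
    Measurable[historySigma ξ w k] (rsgfIterate F γ μ x₁ ξ w k) := by
  induction k, hk using Nat.le_induction with
  | base => exact measurable_const
  | succ k hk ih =>
    have hpoint : Measurable[historySigma ξ w (k + 1)] (rsgfIterate F γ μ x₁ ξ w k) :=
      ih.mono (historySigma_mono k.le_succ) le_rfl
    have hsample := measurable_sample_historySigma (ξ := ξ) (w := w) hk
    have hG := (measurable_gradFree hF μ).comp
      (hsample.snd.prodMk (hsample.fst.prodMk hpoint))
    rw [funext (rsgfIterate_succ hk)]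
    exact hpoint.sub (hG.const_smul (γ k))

end History

namespace IsRSGFRun

variable {n : ℕ} {Ω : Type u} {Ξ : Type v} [MeasurableSpace Ω] [MeasurableSpace Ξ]
  {Pr : Measure Ω} {P : Measure Ξ} {F : E n → Ξ → ℝ} {ξ : ℕ → Ω → Ξ} {w : ℕ → Ω → E n}
  {R : Ω → ℕ} {L σ Dt : ℝ} {γ : ℕ → ℝ} {μ : ℝ} {N k : ℕ}

theorem indepFun_count_iterate (h : IsRSGFRun Pr P F ξ w R L σ Dt γ μ N) (x₁ : E n)
    (hk : k ∈ Icc 1 N) : IndepFun R (rsgfIterate F γ μ x₁ ξ w k) Pr := by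
  obtain ⟨h1k, hkN⟩ := mem_Icc.1 hk
  exact indepFun_of_measurable_comap h.sampling.indep_count
    ((measurable_rsgfIterate h.program.measurable h1k).mono
      (historySigma_mono (Nat.le_succ_of_le hkN)) le_rfl)

theorem indepFun_dir_sample_iterate (h : IsRSGFRun Pr P F ξ w R L σ Dt γ μ N) (x₁ : E n)
    (hk : 1 ≤ k) : IndepFun (w k) (fun ω => (ξ k ω, rsgfIterate F γ μ x₁ ξ w k ω)) Pr := by
  have hpair := comap_measurable (m := inferInstance) fun ω => (ξ k ω, history ξ w k ω)
  exact indepFun_of_measurable_comap (h.sampling.indep_gauss k hk) (hpair.fst.prodMk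
    ((measurable_rsgfIterate h.program.measurable hk).mono hpair.snd.comap_le le_rfl))

variable [IsProbabilityMeasure P]

theorem isC11 (h : IsRSGFRun Pr P F ξ w R L σ Dt γ μ N) : IsC11 L (objective P F) :=
  isC11_objective h.program.integrable h.program.smooth

theorem isOracleCall_of_memLp (h : IsRSGFRun Pr P F ξ w R L σ Dt γ μ N) (hL : 0 ≤ L) {x₁ : E n}
    (hk : 1 ≤ k) (hX : MemLp (rsgfIterate F γ μ x₁ ξ w k) 2 Pr) :
    IsOracleCall (historySigma ξ w k) Pr F (objective P F) L σ (ξ k) (w k)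
      (rsgfIterate F γ μ x₁ ξ w k) where
  le := (measurable_history h.sampling.measurable_noise h.sampling.measurable_gauss).comap_le
  nonneg := hL
  measurable := h.program.measurable
  smooth := h.sampling.smooth k hk
  isC11 := h.isC11
  measurable_sample := h.sampling.measurable_noise k hk
  measurable_dir := h.sampling.measurable_gauss k hk
  measurable_point := measurable_rsgfIterate h.program.measurable hk
  memLp_point := hX
  integrable_value := h.a3.integrable k hk
  condExp_value := h.a3.unbiased k hk
  integrable_grad := h.a1.integrable k hk
  condExp_grad := h.a1.unbiased k hk
  integrable_sq := h.a1.sq_integrable k hk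
  condExp_sq_le := h.a1.variance_le k hk
  map_dir := h.sampling.gauss k hk
  indep := h.indepFun_dir_sample_iterate x₁ hk

variable [IsProbabilityMeasure Pr]

theorem memLp_iterate (h : IsRSGFRun Pr P F ξ w R L σ Dt γ μ N) (hL : 0 ≤ L) (x₁ : E n)
    (hk : 1 ≤ k) : MemLp (rsgfIterate F γ μ x₁ ξ w k) 2 Pr := by
  induction k, hk using Nat.le_induction with
  | base => exact memLp_const x₁
  | succ k hk ih =>
    rw [funext (rsgfIterate_succ hk)]
    exact (h.isOracleCall_of_memLp hL hk ih).memLp_update h.mu_pos (γ k)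

theorem isOracleCall (h : IsRSGFRun Pr P F ξ w R L σ Dt γ μ N) (hL : 0 ≤ L) (x₁ : E n)
    (hk : 1 ≤ k) : IsOracleCall (historySigma ξ w k) Pr F (objective P F) L σ (ξ k) (w k)
      (rsgfIterate F γ μ x₁ ξ w k) :=
  h.isOracleCall_of_memLp hL hk (h.memLp_iterate hL x₁ hk)

end IsRSGFRun

section Rate

variable {n N : ℕ} {L σ Dt : ℝ}

theorem inv_rsgfStep (hL : 0 < L) (hσ : 0 ≤ σ) (hDt : 0 < Dt) (hN : 1 ≤ N) :
    (rsgfStep n L σ Dt N)⁻¹ = max (4 * L * (n + 4)) (σ * √(n + 4) * √N / Dt) := by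
  have hleft : 1 / √(n + 4 : ℝ) * (1 / (4 * L * √(n + 4 : ℝ))) = (4 * L * (n + 4))⁻¹ := by
    field_simp
    rw [Real.sq_sqrt (by positivity)]
  unfold rsgfStep
  split_ifs with h
  · subst h
    rw [hleft, inv_inv, zero_mul, zero_mul, zero_div, max_eq_left (by positivity)]
  · have hright : 1 / √(n + 4 : ℝ) * (Dt / (σ * √N)) = (σ * √(n + 4) * √N / Dt)⁻¹ := by
      field_simp
    have hleftpos : 4 * L * (n + 4) ∈ Set.Ioi (0 : ℝ) := Set.mem_Ioi.2 (by positivity)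
    have hrightpos : σ * √(n + 4) * √N / Dt ∈ Set.Ioi (0 : ℝ) := Set.mem_Ioi.2 (by positivity)
    rw [mul_min_of_nonneg _ _ (by positivity), hleft, hright,
      ← inv_antitoneOn_Ioi.map_max hleftpos hrightpos, inv_inv]

theorem rsgfStep_pos (hL : 0 < L) (hσ : 0 ≤ σ) (hDt : 0 < Dt) (hN : 1 ≤ N) :
    0 < rsgfStep n L σ Dt N := by
  rw [← inv_pos, inv_rsgfStep hL hσ hDt hN]
  exact lt_max_of_lt_left (by positivity)

theorem mul_rsgfStep_le_one (hL : 0 < L) (hσ : 0 ≤ σ) (hDt : 0 < Dt) (hN : 1 ≤ N) :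
    4 * L * (n + 4) * rsgfStep n L σ Dt N ≤ 1 := by
  rw [← le_div_iff₀ (rsgfStep_pos hL hσ hDt hN), one_div, inv_rsgfStep hL hσ hDt hN]
  exact le_max_left _ _

theorem sq_mul_rsgfStep_le (hL : 0 < L) (hσ : 0 ≤ σ) (hDt : 0 < Dt) (hN : 1 ≤ N) :
    (n + 4) * σ ^ 2 * rsgfStep n L σ Dt N ≤ σ * √(n + 4) / √N * Dt := by
  have hc := rsgfStep_pos (n := n) hL hσ hDt hN
  have hright : σ * √(n + 4) * √N / Dt ≤ (rsgfStep n L σ Dt N)⁻¹ :=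
    (le_max_right _ _).trans_eq (inv_rsgfStep hL hσ hDt hN).symm
  rw [← one_div, le_div_iff₀ hc] at hright
  calc (n + 4) * σ ^ 2 * rsgfStep n L σ Dt N
      = σ * √(n + 4) / √N * Dt * (σ * √(n + 4) * √N / Dt * rsgfStep n L σ Dt N) := by
        field_simp
        rw [Real.sq_sqrt (by positivity), mul_comm]
    _ ≤ σ * √(n + 4) / √N * Dt := mul_le_of_le_one_right (by positivity) hright

theorem rsgfPmf_of_const {γ : ℕ → ℝ} {c : ℝ} {k : ℕ} (hγ : ∀ k ∈ Icc 1 N, γ k = c)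
    (hc : c - 2 * L * (n + 4) * c ^ 2 ≠ 0) (hk : k ∈ Icc 1 N) : rsgfPmf n L γ N k = (N : ℝ)⁻¹ := by
  have hsum : ∑ j ∈ Icc 1 N, (γ j - 2 * L * (n + 4) * γ j ^ 2)
      = N * (c - 2 * L * (n + 4) * c ^ 2) := by
    rw [sum_congr rfl fun j hj => by rw [hγ j hj], sum_const, Nat.card_Icc, Nat.add_sub_cancel,
      nsmul_eq_mul]
  rw [rsgfPmf, hsum, hγ k hk, div_mul_cancel_right₀ hc]

theorem div_rsgfStep_add_le {A μ : ℝ} (hL : 0 < L) (hσ : 0 ≤ σ) (hDt : 0 < Dt) (hN : 1 ≤ N)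
    (hμ : μ ^ 2 * ((n + 4) ^ 2 * (2 * N)) ≤ A) :
    A / (rsgfStep n L σ Dt N * N)
        + (2 * (n + 4) * σ ^ 2 * rsgfStep n L σ Dt N + μ ^ 2 * L * (n + 4) ^ 2 / 2)
      ≤ 5 * L * (n + 4) * A / N + 2 * σ * √(n + 4) / √N * (Dt + A / Dt) := by
  have hA : 0 ≤ A := le_trans (by positivity) hμ
  have hinv : A / (rsgfStep n L σ Dt N * N)
      ≤ 4 * L * (n + 4) * A / N + σ * √(n + 4) / √N * (A / Dt) :=
    calc A / (rsgfStep n L σ Dt N * N) = (rsgfStep n L σ Dt N)⁻¹ * (A / N) := by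
          rw [div_mul_eq_div_div, div_right_comm, div_eq_inv_mul]
      _ ≤ (4 * L * (n + 4) + σ * √(n + 4) * √N / Dt) * (A / N) := by
          rw [inv_rsgfStep hL hσ hDt hN]
          gcongr
          exact max_le_add_of_nonneg (by positivity) (by positivity)
      _ = 4 * L * (n + 4) * A / N + σ * √(n + 4) * (√N / N) * (A / Dt) := by ring
      _ = _ := by rw [Real.sqrt_div_self', mul_one_div]
  have hsmoothing : μ ^ 2 * L * (n + 4) ^ 2 / 2 ≤ L * (n + 4) * A / N :=
    calc μ ^ 2 * L * (n + 4) ^ 2 / 2 = L / (4 * N) * (μ ^ 2 * ((n + 4) ^ 2 * (2 * N))) := by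
          field_simp
          norm_num
      _ ≤ L / (4 * N) * A := by gcongr
      _ = L * (1 / 4) * A / N := by ring
      _ ≤ L * (n + 4) * A / N := by
          gcongr
          linarith [Nat.cast_nonneg (α := ℝ) n]
  have hnoise := sq_mul_rsgfStep_le (n := n) hL hσ hDt hN
  have hslack : 0 ≤ σ * √(n + 4) / √N * (A / Dt) := by positivity
  linear_combination hinv + hsmoothing + 2 * hnoise + hslack

end Rate

section Objective

variable {n : ℕ} {f : E n → ℝ} {L : ℝ}

theorem sq_distF (hL : 0 < L) (hb : BddBelow (Set.range f)) (x₁ : E n) :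
    distF L f x₁ ^ 2 = 2 * (f x₁ - optValue f) / L :=
  Real.sq_sqrt (div_nonneg (mul_nonneg zero_le_two (sub_nonneg.2 (ciInf_le hb x₁))) hL.le)

theorem bddBelow_range_of_isMinOn {y : E n} (hy : IsMinOn f Set.univ y) : BddBelow (Set.range f) :=
  ⟨f y, Set.forall_mem_range.2 (isMinOn_univ_iff.1 hy)⟩

theorem optValue_eq_of_isMinOn {y : E n} (hy : IsMinOn f Set.univ y) : optValue f = f y :=
  le_antisymm (ciInf_le (bddBelow_range_of_isMinOn hy) y) (le_ciInf (isMinOn_univ_iff.1 hy))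

theorem sq_distF_le_sq_norm_sub (hL : 0 < L) (hf : IsC11 L f) {y : E n}
    (hy : IsMinOn f Set.univ y) (x₁ : E n) : distF L f x₁ ^ 2 ≤ ‖x₁ - y‖ ^ 2 := by
  have hsmooth := hf.le_add_inner y (x₁ - y)
  rw [gradient_eq_zero_of_isLocalMin (hy.isLocalMin Filter.univ_mem), inner_zero_left, add_zero,
    add_sub_cancel] at hsmooth
  rw [sq_distF hL (bddBelow_range_of_isMinOn hy), optValue_eq_of_isMinOn hy, div_le_iff₀ hL]
  linarith

end Objective

namespace IsRSGFRun

variable {n : ℕ} {Ω : Type u} {Ξ : Type v} [MeasurableSpace Ω] [MeasurableSpace Ξ]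
  {Pr : Measure Ω} {P : Measure Ξ} {F : E n → Ξ → ℝ} {ξ : ℕ → Ω → Ξ} {w : ℕ → Ω → E n}
  {R : Ω → ℕ} {L σ Dt : ℝ} {γ : ℕ → ℝ} {μ : ℝ} {N : ℕ}

theorem measureReal_count_eq (h : IsRSGFRun Pr P F ξ w R L σ Dt γ μ N) (hL : 0 < L) (hσ : 0 ≤ σ)
    (hDt : 0 < Dt) (hN : 1 ≤ N) {k : ℕ} (hk : k ∈ Icc 1 N) : Pr.real (R ⁻¹' {k}) = (N : ℝ)⁻¹ := by
  have hc := rsgfStep_pos (n := n) hL hσ hDt hN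
  have hcL := mul_rsgfStep_le_one (n := n) hL hσ hDt hN
  refine (h.sampling.pmf k hk).trans (rsgfPmf_of_const h.step (ne_of_gt ?_) hk)
  nlinarith

theorem sq_smoothing_mul_le (h : IsRSGFRun Pr P F ξ w R L σ Dt γ μ N) (hN : 1 ≤ N) {x₁ : E n}
    (hμ : μ ≤ distF L (objective P F) x₁ / ((n + 4) * √(2 * N))) :
    μ ^ 2 * ((n + 4) ^ 2 * (2 * N)) ≤ distF L (objective P F) x₁ ^ 2 := by
  have hN' : (0 : ℝ) < N := mod_cast hN
  rw [le_div_iff₀ (by positivity)] at hμ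
  have hsq := pow_le_pow_left₀ (mul_nonneg h.mu_pos.le (by positivity)) hμ 2
  rwa [mul_pow, mul_pow, Real.sq_sqrt (by positivity)] at hsq

variable [IsProbabilityMeasure Pr]

theorem integral_output_eq (h : IsRSGFRun Pr P F ξ w R L σ Dt γ μ N) (hL : 0 < L) (hσ : 0 ≤ σ)
    (hDt : 0 < Dt) (hN : 1 ≤ N) {φ : E n → ℝ} (hφ : Measurable φ) {x₁ : E n}
    (hint : ∀ k ∈ Icc 1 N, Integrable (fun ω => φ (rsgfIterate F γ μ x₁ ξ w k ω)) Pr) :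
    Integrable (fun ω => φ (rsgfOutput F γ μ x₁ ξ w R ω)) Pr ∧
      ∫ ω, φ (rsgfOutput F γ μ x₁ ξ w R ω) ∂Pr
        = (∑ k ∈ Icc 1 N, ∫ ω, φ (rsgfIterate F γ μ x₁ ξ w k ω) ∂Pr) / N := by
  have hpmf : ∀ k ∈ Icc 1 N, Pr.real (R ⁻¹' {k}) = (N : ℝ)⁻¹ := fun k hk =>
    h.measureReal_count_eq hL hσ hDt hN hk
  have htotal : ∑ k ∈ Icc 1 N, Pr.real (R ⁻¹' {k}) = 1 := by
    rw [sum_congr rfl hpmf, sum_const, Nat.card_Icc, Nat.add_sub_cancel, nsmul_eq_mul,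
      mul_inv_cancel₀ (Nat.cast_ne_zero.2 (Nat.one_le_iff_ne_zero.1 hN))]
  obtain ⟨hout, hsum⟩ := integral_comp_index_of_indepFun h.sampling.measurable_count htotal hint
    fun k hk => (h.indepFun_count_iterate x₁ hk).comp measurable_id hφ
  refine ⟨hout, hsum.trans ?_⟩
  rw [sum_congr rfl fun k hk => by rw [hpmf k hk], ← mul_sum, inv_mul_eq_div]

theorem integral_output_le_of_lyapunov (h : IsRSGFRun Pr P F ξ w R L σ Dt γ μ N) (hL : 0 < L)
    (hσ : 0 ≤ σ) (hDt : 0 < Dt) (hN : 1 ≤ N) {φ : E n → ℝ} (hφ : Measurable φ) {x₁ : E n}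
    (hint : ∀ k ∈ Icc 1 N, Integrable (fun ω => φ (rsgfIterate F γ μ x₁ ξ w k ω)) Pr)
    {V : ℕ → ℝ} (hV : 0 ≤ V (N + 1)) (hμ : μ ^ 2 * ((n + 4) ^ 2 * (2 * N)) ≤ V 1)
    (hstep : ∀ k ∈ Icc 1 N, V (k + 1) + γ k * ∫ ω, φ (rsgfIterate F γ μ x₁ ξ w k ω) ∂Pr
      ≤ V k + γ k * (2 * (n + 4) * σ ^ 2 * γ k + μ ^ 2 * L * (n + 4) ^ 2 / 2)) :
    Integrable (fun ω => φ (rsgfOutput F γ μ x₁ ξ w R ω)) Pr ∧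
      ∫ ω, φ (rsgfOutput F γ μ x₁ ξ w R ω) ∂Pr
        ≤ 5 * L * (n + 4) * V 1 / N + 2 * σ * √(n + 4) / √N * (Dt + V 1 / Dt) := by
  obtain ⟨hout, hmean⟩ := h.integral_output_eq hL hσ hDt hN hφ hint
  refine ⟨hout, hmean.trans_le (le_trans ?_ (div_rsgfStep_add_le hL hσ hDt hN hμ))⟩
  have hc := rsgfStep_pos (n := n) hL hσ hDt hN
  set c := rsgfStep n L σ Dt N
  set S := ∑ k ∈ Icc 1 N, ∫ ω, φ (rsgfIterate F γ μ x₁ ξ w k ω) ∂Pr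
  set e := 2 * (n + 4) * σ ^ 2 * c + μ ^ 2 * L * (n + 4) ^ 2 / 2
  have htelescope : V (N + 1) + c * S ≤ V 1 + N * (c * e) :=
    add_mul_sum_Icc_le_of_step N fun k hk => by simpa only [h.step k hk] using hstep k hk
  calc S / N = c * S / (c * N) := (mul_div_mul_left _ _ hc.ne').symm
    _ ≤ (V 1 + N * (c * e)) / (c * N) := by
        gcongr
        linarith
    _ = V 1 / (c * N) + e := by field_simp

variable [IsProbabilityMeasure P]

theorem optValue_le_integral_iterate (h : IsRSGFRun Pr P F ξ w R L σ Dt γ μ N) (hL : 0 ≤ L)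
    (x₁ : E n) {k : ℕ} (hk : 1 ≤ k) :
    optValue (objective P F) ≤ ∫ ω, objective P F (rsgfIterate F γ μ x₁ ξ w k ω) ∂Pr :=
  calc optValue (objective P F) = ∫ _, optValue (objective P F) ∂Pr := by
        rw [integral_const, probReal_univ, one_smul]
    _ ≤ _ := integral_mono (integrable_const _)
        (h.isC11.integrable_comp (h.memLp_iterate hL x₁ hk))
        fun ω => ciInf_le h.program.bddBelow (rsgfIterate F γ μ x₁ ξ w k ω)

theorem integral_objective_iterate_succ_add_le (h : IsRSGFRun Pr P F ξ w R L σ Dt γ μ N)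
    (hL : 0 < L) (hσ : 0 ≤ σ) (hDt : 0 < Dt) (x₁ : E n) (a : ℝ) {k : ℕ} (hk : k ∈ Icc 1 N) :
    2 / L * (∫ ω, objective P F (rsgfIterate F γ μ x₁ ξ w (k + 1) ω) ∂Pr - a)
        + γ k * ∫ ω, ‖gradient (objective P F) (rsgfIterate F γ μ x₁ ξ w k ω)‖ ^ 2 / (2 * L) ∂Pr
      ≤ 2 / L * (∫ ω, objective P F (rsgfIterate F γ μ x₁ ξ w k ω) ∂Pr - a)
        + γ k * (2 * (n + 4) * σ ^ 2 * γ k + μ ^ 2 * L * (n + 4) ^ 2 / 2) := by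
  obtain ⟨h1k, hkN⟩ := mem_Icc.1 hk
  have hN := h1k.trans hkN
  simp only [rsgfIterate_succ h1k]
  have hdescent := (h.isOracleCall hL.le x₁ h1k).integral_update_add_le h.mu_pos
    (h.step k hk ▸ (rsgfStep_pos hL hσ hDt hN).le)
    (h.step k hk ▸ mul_rsgfStep_le_one hL hσ hDt hN)
  rw [integral_div]
  refine (Eq.trans_le ?_ (mul_le_mul_of_nonneg_left (sub_le_sub_right hdescent a)
    (by positivity : 0 ≤ 2 / L))).trans_eq ?_
  · field_simp
    ring
  · field_simp
    ring

theorem integral_sq_norm_iterate_succ_sub_add_le (h : IsRSGFRun Pr P F ξ w R L σ Dt γ μ N)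
    (hL : 0 < L) (hσ : 0 ≤ σ) (hDt : 0 < Dt) (x₁ : E n)
    (hconv : ConvexOn ℝ Set.univ (objective P F)) {y : E n}
    (hy : IsMinOn (objective P F) Set.univ y) {k : ℕ} (hk : k ∈ Icc 1 N) :
    ∫ ω, ‖rsgfIterate F γ μ x₁ ξ w (k + 1) ω - y‖ ^ 2 ∂Pr
        + γ k * ∫ ω, (objective P F (rsgfIterate F γ μ x₁ ξ w k ω) - objective P F y) ∂Pr
      ≤ ∫ ω, ‖rsgfIterate F γ μ x₁ ξ w k ω - y‖ ^ 2 ∂Pr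
        + γ k * (2 * (n + 4) * σ ^ 2 * γ k + μ ^ 2 * L * (n + 4) ^ 2 / 2) := by
  obtain ⟨h1k, hkN⟩ := mem_Icc.1 hk
  have hN := h1k.trans hkN
  simp only [rsgfIterate_succ h1k]
  exact (h.isOracleCall hL.le x₁ h1k).integral_sq_norm_update_sub_add_le hL h.mu_pos
    (h.step k hk ▸ (rsgfStep_pos hL hσ hDt hN).le)
    (h.step k hk ▸ mul_rsgfStep_le_one hL hσ hDt hN) hconv hy

theorem integral_sq_norm_gradient_output_le (h : IsRSGFRun Pr P F ξ w R L σ Dt γ μ N)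
    (hL : 0 < L) (hσ : 0 ≤ σ) (hDt : 0 < Dt) (hN : 1 ≤ N) {x₁ : E n}
    (hμ : μ ≤ distF L (objective P F) x₁ / ((n + 4) * √(2 * N))) :
    Integrable (fun ω => ‖gradient (objective P F) (rsgfOutput F γ μ x₁ ξ w R ω)‖ ^ 2) Pr ∧
      1 / L * ∫ ω, ‖gradient (objective P F) (rsgfOutput F γ μ x₁ ξ w R ω)‖ ^ 2 ∂Pr
        ≤ 12 * (n + 4) * L * distF L (objective P F) x₁ ^ 2 / N
          + 4 * σ * √(n + 4) / √N * (Dt + distF L (objective P F) x₁ ^ 2 / Dt) := by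
  have hV_one : 2 / L * (∫ ω, objective P F (rsgfIterate F γ μ x₁ ξ w 1 ω) ∂Pr
      - optValue (objective P F)) = distF L (objective P F) x₁ ^ 2 := by
    simp only [rsgfIterate, integral_const, probReal_univ, one_smul]
    rw [sq_distF hL h.program.bddBelow, mul_div_right_comm]
  have hV_nonneg : 0 ≤ 2 / L * (∫ ω, objective P F (rsgfIterate F γ μ x₁ ξ w (N + 1) ω) ∂Pr
      - optValue (objective P F)) :=
    mul_nonneg (by positivity)
      (sub_nonneg.2 (h.optValue_le_integral_iterate hL.le x₁ N.succ_pos))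
  obtain ⟨hint, hle⟩ := h.integral_output_le_of_lyapunov hL hσ hDt hN
    (φ := fun x => ‖gradient (objective P F) x‖ ^ 2 / (2 * L))
    (V := fun k => 2 / L * (∫ ω, objective P F (rsgfIterate F γ μ x₁ ξ w k ω) ∂Pr
      - optValue (objective P F)))
    ((h.isC11.continuous_gradient.norm.pow 2).div_const _).measurable
    (fun k hk => (h.isOracleCall hL.le x₁ (mem_Icc.1 hk).1).integrable_sq_norm_gradient.div_const _)
    hV_nonneg ((h.sq_smoothing_mul_le hN hμ).trans_eq hV_one.symm)
    fun k hk => h.integral_objective_iterate_succ_add_le hL hσ hDt x₁ _ hk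
  constructor
  · simpa only [div_mul_cancel₀ _ (by positivity : 2 * L ≠ 0)] using hint.mul_const (2 * L)
  · rw [integral_div, hV_one] at hle
    have hslack : 0 ≤ L * (n + 4) * distF L (objective P F) x₁ ^ 2 / N := by positivity
    linear_combination 2 * hle + 2 * hslack

theorem integral_objective_output_le (h : IsRSGFRun Pr P F ξ w R L σ Dt γ μ N)
    (hL : 0 < L) (hσ : 0 ≤ σ) (hDt : 0 < Dt) (hN : 1 ≤ N) {x₁ y : E n}
    (hμ : μ ≤ distF L (objective P F) x₁ / ((n + 4) * √(2 * N)))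
    (hconv : ConvexOn ℝ Set.univ (objective P F)) (hy : IsMinOn (objective P F) Set.univ y) :
    Integrable (fun ω => objective P F (rsgfOutput F γ μ x₁ ξ w R ω)
        - optValue (objective P F)) Pr ∧
      ∫ ω, (objective P F (rsgfOutput F γ μ x₁ ξ w R ω) - optValue (objective P F)) ∂Pr
        ≤ 5 * L * (n + 4) * ‖x₁ - y‖ ^ 2 / N
          + 2 * σ * √(n + 4) / √N * (Dt + ‖x₁ - y‖ ^ 2 / Dt) := by
  have hV_one : ∫ ω, ‖rsgfIterate F γ μ x₁ ξ w 1 ω - y‖ ^ 2 ∂Pr = ‖x₁ - y‖ ^ 2 := by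
    simp only [rsgfIterate, integral_const, probReal_univ, one_smul]
  have hμy := (h.sq_smoothing_mul_le hN hμ).trans (sq_distF_le_sq_norm_sub hL h.isC11 hy x₁)
  rw [optValue_eq_of_isMinOn hy, ← hV_one]
  exact h.integral_output_le_of_lyapunov hL hσ hDt hN
    (φ := fun x => objective P F x - objective P F y)
    (V := fun k => ∫ ω, ‖rsgfIterate F γ μ x₁ ξ w k ω - y‖ ^ 2 ∂Pr)
    (h.isC11.continuous.measurable.sub_const _)
    (fun k hk => (h.isC11.integrable_comp (h.memLp_iterate hL.le x₁ (mem_Icc.1 hk).1)).sub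
      (integrable_const _))
    (integral_nonneg fun ω => sq_nonneg _) (hμy.trans_eq hV_one.symm)
    fun k hk => h.integral_sq_norm_iterate_succ_sub_add_le hL hσ hDt x₁ hconv hy hk

theorem integral_sq_norm_gradient_output_le_of_distF_le
    (h : IsRSGFRun Pr P F ξ w R L σ Dt γ μ N) (hL : 0 < L) (hσ : 0 ≤ σ) (hDt : 0 < Dt)
    (hN : 1 ≤ N) {x₁ : E n} {D : ℝ}
    (hμ : μ ≤ distF L (objective P F) x₁ / ((n + 4) * √(2 * N)))
    (hD : distF L (objective P F) x₁ ≤ D) :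
    ∫ ω, ‖gradient (objective P F) (rsgfOutput F γ μ x₁ ξ w R ω)‖ ^ 2 ∂Pr
      ≤ 12 * L ^ 2 * D ^ 2 * (n + 4) / N
        + 4 * L * σ * (Dt + D ^ 2 / Dt) * √(n + 4) / √N := by
  have hle := (h.integral_sq_norm_gradient_output_le hL hσ hDt hN hμ).2
  rw [one_div_mul_eq_div, div_le_iff₀ hL] at hle
  have hD0 : 0 ≤ distF L (objective P F) x₁ := Real.sqrt_nonneg _
  calc _ ≤ _ := hle
    _ ≤ (12 * (n + 4) * L * D ^ 2 / N + 4 * σ * √(n + 4) / √N * (Dt + D ^ 2 / Dt)) * L := by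
        gcongr
    _ = _ := by ring

theorem integral_objective_output_le_of_norm_sub_le (h : IsRSGFRun Pr P F ξ w R L σ Dt γ μ N)
    (hL : 0 < L) (hσ : 0 ≤ σ) (hDt : 0 < Dt) (hN : 1 ≤ N) {x₁ y : E n} {D : ℝ}
    (hμ : μ ≤ distF L (objective P F) x₁ / ((n + 4) * √(2 * N)))
    (hconv : ConvexOn ℝ Set.univ (objective P F)) (hy : IsMinOn (objective P F) Set.univ y)
    (hD : ‖x₁ - y‖ ≤ D) :
    ∫ ω, (objective P F (rsgfOutput F γ μ x₁ ξ w R ω) - optValue (objective P F)) ∂Pr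
      ≤ 5 * L * D ^ 2 * (n + 4) / N + 2 * σ * (Dt + D ^ 2 / Dt) * √(n + 4) / √N :=
  calc _ ≤ _ := (h.integral_objective_output_le hL hσ hDt hN hμ hconv hy).2
    _ ≤ 5 * L * (n + 4) * D ^ 2 / N + 2 * σ * √(n + 4) / √N * (Dt + D ^ 2 / Dt) := by gcongr
    _ = _ := by ring

end IsRSGFRun

theorem exists_pos_forall_mul_div_add_mul_sqrt_div_le {p q : ℝ} (hp : 0 ≤ p) (hq : 0 ≤ q) :
    ∃ C : ℝ, 0 < C ∧ ∀ (n N : ℕ) (ε : ℝ), 1 ≤ n → 0 < ε → ε ≤ 1 → C * (n / ε ^ 2) ≤ N →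
      1 ≤ N ∧ p * (n + 4) / N + q * √(n + 4) / √N ≤ ε := by
  have hK : 0 < 1 + 9 * p + 3 * q := by positivity
  refine ⟨(1 + 9 * p + 3 * q) ^ 2, by positivity, fun n N ε hn hε hε1 hN => ?_⟩
  have hn' : (1 : ℝ) ≤ n := mod_cast hn
  have hN' : (0 : ℝ) < N := lt_of_lt_of_le (by positivity) hN
  set K := 1 + 9 * p + 3 * q
  have hratio : (n + 4) / N ≤ (3 * ε / K) ^ 2 := by
    rw [div_le_iff₀ hN']
    calc (n : ℝ) + 4 ≤ 9 * n := by linarith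
      _ = (3 * ε / K) ^ 2 * (K ^ 2 * (n / ε ^ 2)) := by field_simp; norm_num
      _ ≤ (3 * ε / K) ^ 2 * N := by gcongr
  have hsqrt : √(n + 4) / √N ≤ 3 * ε / K := by
    rw [← Real.sqrt_div' _ hN'.le]
    exact Real.sqrt_le_iff.2 ⟨by positivity, hratio⟩
  have hεK : ε / K ≤ 1 := (div_le_one hK).2 (by linarith)
  refine ⟨mod_cast hN', ?_⟩
  calc p * (n + 4) / N + q * √(n + 4) / √N
      = p * ((n + 4) / N) + q * (√(n + 4) / √N) := by ring
    _ ≤ p * (3 * ε / K) ^ 2 + q * (3 * ε / K) := by gcongr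
    _ = ε / K * (9 * p * (ε / K) + 3 * q) := by ring
    _ ≤ ε / K * (9 * p * 1 + 3 * q) := by gcongr
    _ ≤ ε / K * K := by gcongr; linarith
    _ = ε := div_mul_cancel₀ ε hK.ne'

theorem mainTheorem6_general (L σ Dt : ℝ) (hL : 0 < L) (hσ : 0 ≤ σ) (hDt : 0 < Dt) :
    (∀ (n : ℕ) (Ω : Type u) (Ξ : Type v) [MeasurableSpace Ω] [MeasurableSpace Ξ]
        (Pr : Measure Ω) [IsProbabilityMeasure Pr] (P : Measure Ξ) [IsProbabilityMeasure P]
        (F : E n → Ξ → ℝ) (ξ : ℕ → Ω → Ξ) (w : ℕ → Ω → E n) (R : Ω → ℕ) (γ : ℕ → ℝ) (μ : ℝ)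
        (N : ℕ) (x₁ : E n),
        1 ≤ N → IsRSGFRun Pr P F ξ w R L σ Dt γ μ N →
        μ ≤ distF L (objective P F) x₁ / ((n + 4) * √(2 * N)) →
        (Integrable (fun ω => ‖gradient (objective P F) (rsgfOutput F γ μ x₁ ξ w R ω)‖ ^ 2) Pr ∧
          1 / L * ∫ ω, ‖gradient (objective P F) (rsgfOutput F γ μ x₁ ξ w R ω)‖ ^ 2 ∂Pr
            ≤ 12 * (n + 4) * L * distF L (objective P F) x₁ ^ 2 / N
              + 4 * σ * √(n + 4) / √N * (Dt + distF L (objective P F) x₁ ^ 2 / Dt)) ∧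
        (∀ xstar : E n, ConvexOn ℝ Set.univ (objective P F) →
          IsMinOn (objective P F) Set.univ xstar →
          Integrable (fun ω => objective P F (rsgfOutput F γ μ x₁ ξ w R ω)
              - optValue (objective P F)) Pr ∧
            ∫ ω, (objective P F (rsgfOutput F γ μ x₁ ξ w R ω) - optValue (objective P F)) ∂Pr
              ≤ 5 * L * (n + 4) * ‖x₁ - xstar‖ ^ 2 / N
                + 2 * σ * √(n + 4) / √N * (Dt + ‖x₁ - xstar‖ ^ 2 / Dt))) ∧
    (∀ D : ℝ, ∃ C : ℝ, 0 < C ∧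
      ∀ (n : ℕ) (Ω : Type u) (Ξ : Type v) [MeasurableSpace Ω] [MeasurableSpace Ξ]
        (Pr : Measure Ω) [IsProbabilityMeasure Pr] (P : Measure Ξ) [IsProbabilityMeasure P]
        (F : E n → Ξ → ℝ) (ξ : ℕ → Ω → Ξ) (w : ℕ → Ω → E n) (R : Ω → ℕ) (γ : ℕ → ℝ) (μ : ℝ)
        (N : ℕ) (x₁ : E n) (ε : ℝ),
        1 ≤ n → 0 < ε → ε ≤ 1 → C * (n / ε ^ 2) ≤ N →
        IsRSGFRun Pr P F ξ w R L σ Dt γ μ N →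
        μ ≤ distF L (objective P F) x₁ / ((n + 4) * √(2 * N)) →
        (distF L (objective P F) x₁ ≤ D →
          ∫ ω, ‖gradient (objective P F) (rsgfOutput F γ μ x₁ ξ w R ω)‖ ^ 2 ∂Pr ≤ ε) ∧
        (∀ xstar : E n, ConvexOn ℝ Set.univ (objective P F) →
          IsMinOn (objective P F) Set.univ xstar → ‖x₁ - xstar‖ ≤ D →
          ∫ ω, (objective P F (rsgfOutput F γ μ x₁ ξ w R ω) - optValue (objective P F)) ∂Pr
            ≤ ε)) := by
  refine ⟨fun n Ω Ξ _ _ Pr _ P _ F ξ w R γ μ N x₁ hN hrun hμ =>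
    ⟨hrun.integral_sq_norm_gradient_output_le hL hσ hDt hN hμ, fun xstar hconv hmin =>
      hrun.integral_objective_output_le hL hσ hDt hN hμ hconv hmin⟩, fun D => ?_⟩
  obtain ⟨C₁, hC₁, hgrad⟩ := exists_pos_forall_mul_div_add_mul_sqrt_div_le
    (by positivity : 0 ≤ 12 * L ^ 2 * D ^ 2) (by positivity : 0 ≤ 4 * L * σ * (Dt + D ^ 2 / Dt))
  obtain ⟨C₂, -, hgap⟩ := exists_pos_forall_mul_div_add_mul_sqrt_div_le
    (by positivity : 0 ≤ 5 * L * D ^ 2) (by positivity : 0 ≤ 2 * σ * (Dt + D ^ 2 / Dt))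
  refine ⟨max C₁ C₂, lt_max_of_lt_left hC₁, ?_⟩
  intro n Ω Ξ _ _ Pr _ P _ F ξ w R γ μ N x₁ ε hn hε hε1 hNC hrun hμ
  rw [max_mul_of_nonneg _ _ (by positivity), max_le_iff] at hNC
  obtain ⟨hN, hgradε⟩ := hgrad n N ε hn hε hε1 hNC.1
  obtain ⟨-, hgapε⟩ := hgap n N ε hn hε hε1 hNC.2
  exact ⟨fun hD =>
      (hrun.integral_sq_norm_gradient_output_le_of_distF_le hL hσ hDt hN hμ hD).trans hgradε,
    fun xstar hconv hmin hD => (hrun.integral_objective_output_le_of_norm_sub_le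
      hL hσ hDt hN hμ hconv hmin hD).trans hgapε⟩

theorem mainTheorem6 (L σ Dt : ℝ) (hL : 0 < L) (hσ : 0 ≤ σ) (hDt : 0 < Dt) :
    -- the two bounds
    (∀ (n : ℕ) (Ω : Type u) (Ξ : Type v) [MeasurableSpace Ω] [MeasurableSpace Ξ]
        [StandardBorelSpace Ξ] (Pr : Measure Ω) [IsProbabilityMeasure Pr] (P : Measure Ξ)
        [IsProbabilityMeasure P] (F : E n → Ξ → ℝ) (ξ : ℕ → Ω → Ξ) (w : ℕ → Ω → E n)
        (R : Ω → ℕ) (γ : ℕ → ℝ) (μ : ℝ) (N : ℕ) (x₁ : E n),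
        1 ≤ N → IsRSGFRun Pr P F ξ w R L σ Dt γ μ N →
        μ ≤ distF L (objective P F) x₁ / ((n + 4) * √(2 * N)) →
        (Integrable (fun ω => ‖gradient (objective P F) (rsgfOutput F γ μ x₁ ξ w R ω)‖ ^ 2) Pr ∧
          1 / L * ∫ ω, ‖gradient (objective P F) (rsgfOutput F γ μ x₁ ξ w R ω)‖ ^ 2 ∂Pr
            ≤ 12 * (n + 4) * L * distF L (objective P F) x₁ ^ 2 / N
              + 4 * σ * √(n + 4) / √N * (Dt + distF L (objective P F) x₁ ^ 2 / Dt)) ∧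
        (∀ xstar : E n, ConvexOn ℝ Set.univ (objective P F) →
          IsMinOn (objective P F) Set.univ xstar →
          μ ≤ ‖x₁ - xstar‖ / √(n + 4) →
          Integrable (fun ω => objective P F (rsgfOutput F γ μ x₁ ξ w R ω)
              - optValue (objective P F)) Pr ∧
            ∫ ω, (objective P F (rsgfOutput F γ μ x₁ ξ w R ω) - optValue (objective P F)) ∂Pr
              ≤ 5 * L * (n + 4) * ‖x₁ - xstar‖ ^ 2 / N
                + 2 * σ * √(n + 4) / √N * (Dt + ‖x₁ - xstar‖ ^ 2 / Dt))) ∧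
    -- `O(n / ε²)` iterations give an `ε`-solution; the constant depends on `L`, `σ`, `Dt` and an
    -- upper bound `D` of `D_f`, respectively `D_X`, only
    (∀ D : ℝ, ∃ C : ℝ, 0 < C ∧
      ∀ (n : ℕ) (Ω : Type u) (Ξ : Type v) [MeasurableSpace Ω] [MeasurableSpace Ξ]
        [StandardBorelSpace Ξ] (Pr : Measure Ω) [IsProbabilityMeasure Pr] (P : Measure Ξ)
        [IsProbabilityMeasure P] (F : E n → Ξ → ℝ) (ξ : ℕ → Ω → Ξ) (w : ℕ → Ω → E n)
        (R : Ω → ℕ) (γ : ℕ → ℝ) (μ : ℝ) (N : ℕ) (x₁ : E n) (ε : ℝ),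
        1 ≤ n → 0 < ε → ε ≤ 1 → C * (n / ε ^ 2) ≤ N →
        IsRSGFRun Pr P F ξ w R L σ Dt γ μ N →
        μ ≤ distF L (objective P F) x₁ / ((n + 4) * √(2 * N)) →
        (distF L (objective P F) x₁ ≤ D →
          ∫ ω, ‖gradient (objective P F) (rsgfOutput F γ μ x₁ ξ w R ω)‖ ^ 2 ∂Pr ≤ ε) ∧
        (∀ xstar : E n, ConvexOn ℝ Set.univ (objective P F) →
          IsMinOn (objective P F) Set.univ xstar →
          μ ≤ ‖x₁ - xstar‖ / √(n + 4) → ‖x₁ - xstar‖ ≤ D →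
          ∫ ω, (objective P F (rsgfOutput F γ μ x₁ ξ w R ω) - optValue (objective P F)) ∂Pr
            ≤ ε)) := by
  obtain ⟨hrates, hcomplexity⟩ := mainTheorem6_general.{u, v} L σ Dt hL hσ hDt
  exact ⟨fun n Ω Ξ _ _ _ Pr _ P _ F ξ w R γ μ N x₁ hN hrun hμ =>
      (hrates n Ω Ξ Pr P F ξ w R γ μ N x₁ hN hrun hμ).imp_right fun hgap y hconv hy _ =>
        hgap y hconv hy,
    fun D => (hcomplexity D).imp fun C => And.imp_right
      fun hC n Ω Ξ _ _ _ Pr _ P _ F ξ w R γ μ N x₁ ε hn hε hε1 hN hrun hμ =>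
        (hC n Ω Ξ Pr P F ξ w R γ μ N x₁ ε hn hε hε1 hN hrun hμ).imp_right fun hgap y hconv hy _ =>
          hgap y hconv hy⟩
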